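/- **Conventions.** Let $d_1,d_2$ be dimensions, let $\Gamma<\mathbb R^{d_1}\times\mathbb R^{d_2}$ be a lattice (a discrete subgroup spanning $\mathbb R^{d_1}\times\mathbb R^{d_2}$) which projects injectively to $\mathbb R^{d_1}$ and densely to $\mathbb R^{d_2}$, and let $W\subset\mathbb R^{d_2}$ be a relatively compact Borel set whose interior is dense in $W$. The *cut-and-project process* $p=p(\mathbb R^{d_1},\mathbb R^{d_2},\Gamma,W)$ is defined on the torus $\Omega=\Gamma\backslash(\mathbb R^{d_1}\times\mathbb R^{d_2})$ with its invariant probability measure by $$p_{\Gamma(g,h)}=\sum_{x\in\Lambda_{\Gamma(g,h)}}\delta_x,\qquad \Lambda_{\Gamma(g,h)}=\operatorname{pr}_1\bigl(\Gamma\cap(\mathbb R^{d_1}\times(W-h))\bigr)+g .$$ For a random measure $p$ on $\mathbb R^{d}$ with moment measures $M^1_p=\mathbb E[p_\omega]=i(p)\operatorname{Vol}_{d}$ and $M^2_p=\mathbb E[p_\omega\otimes p_\omega]$, the autocorrelation is the measure $\eta_p^+(f)=\int f(x-y)\rho(y)\,dM^2_p(x,y)$, where $\rho\ge 0$ is any bounded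 Borel function of bounded support and integral $1$; the centered autocorrelation is $\eta_p=\eta_p^+-i(p)^2\operatorname{Vol}_{d}$; and the *centered diffraction* $\widehat\eta_p$ is its Fourier transform, i.e. the unique positive Radon measure on $\mathbb R^{d}$ with $\widehat\eta_p(|\widehat f|^2)=\eta_p(f*f^*)$ for all $f\in C_c(\mathbb R^{d})$, where $\widehat f(\xi)=\int f(x)e^{-2\pi i\langle x,\xi\rangle}dx$ and $f^*(x)=\overline{f(-x)}$. The process $p$ is *hyperuniform* if $\lim_{t\to0^+}\widehat\eta_p(B_t)/t^{d}=0$, where $B_t$ denotes the Euclidean ball of radius $t$ around $0$. A Borel set $W\subset\mathbb R^{d}$ is *Fourier smooth with exponent* $\vartheta>0$ if there is a constant $C$ such that $|\widehat{\chi}_W(\xi)|\le C(1+\|\xi\|)^{-(d+\vartheta)/2}$ for all $\xi$. The *dual lattice* $\Gamma^\perp$ is the set of all $\xi\in\mathbb R^{d_1}\times\mathbb R^{d_2}$ with $e^{2\pi i\langle\gamma,\xi\rangle}=1$ for all $\gamma\in\Gamma$. A lattice $L<\mathbb R^{d_1}\times\mathbb R^{d_2}$ is *$\beta$-repellent on the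 right* if there is $\varepsilon_0>0$ such that for all $(\gamma_1,\gamma_2)\in L\setminus\{(0,0)\}$ and all $0<\varepsilon<\varepsilon_0$, $\|\gamma_1\|_\infty<\varepsilon$ implies $\|\gamma_2\|_\infty\ge\varepsilon^{-\beta}$. **Theorem.** Let $p=p(\mathbb R^{d_1},\mathbb R^{d_2},\Gamma,W)$ be as above, where $W$ is Fourier smooth with exponent $\vartheta>0$, and assume that $\Gamma^\perp$ is $\beta$-repellent on the right for some $\beta>0$. Then the centered diffraction $\widehat\eta_p$ exists and is unique, and there are constants $C,\varepsilon_0>0$ such that for all $0<\varepsilon<\varepsilon_0$ $$\widehat\eta_p(B_\varepsilon)\le C\,\varepsilon^{\beta(d_2+\vartheta)}\qquad\text{and}\qquad \frac{\widehat\eta_p(B_\varepsilon)}{\operatorname{Vol}_{d_1}(B_\varepsilon)}\le C\,\varepsilon^{\beta(d_2+\vartheta)-d_1}.$$ In particular, $p$ is hyperuniform provided that $\beta>\dfrac{d_1}{d_2+\vartheta}$. -/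

import Mathlib

open MeasureTheory Set Filter Topology
open scoped ENNReal FourierTransform Convolution

noncomputable section

/-! ### Random measures on Euclidean space, autocorrelation and diffraction -/

section RandomMeasures

variable {Ω : Type*} [MeasurableSpace Ω] {d : ℕ}

/-- The first moment measure `M¹_p(A) = 𝔼[p_ω(A)]` of a random measure `p` on `ℝ^d`. -/
def firstMoment (P : Measure Ω) (p : Ω → Measure (EuclideanSpace ℝ (Fin d))) :
    Measure (EuclideanSpace ℝ (Fin d)) :=
  P.bind p

/-- The second moment measure `M²_p(B) = 𝔼[(p_ω ⊗ p_ω)(B)]`. -/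
def secondMoment (P : Measure Ω) (p : Ω → Measure (EuclideanSpace ℝ (Fin d))) :
    Measure (EuclideanSpace ℝ (Fin d) × EuclideanSpace ℝ (Fin d)) :=
  P.bind (fun ω => (p ω).prod (p ω))

/-- The intensity `i(p)`, that is the constant with `M¹_p = i(p) · Vol_d` when `p` is invariant
(evaluated on the Euclidean unit ball). -/
def intensity (P : Measure Ω) (p : Ω → Measure (EuclideanSpace ℝ (Fin d))) : ℝ :=
  (firstMoment P p (Metric.ball 0 1) /
    volume (Metric.ball (0 : EuclideanSpace ℝ (Fin d)) 1)).toReal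

/-- The weight `ρ`, a nonnegative bounded Borel function with bounded support and integral one:
the normalized indicator function of the Euclidean unit ball. -/
def unitWeight (d : ℕ) : EuclideanSpace ℝ (Fin d) → ℝ≥0∞ :=
  (Metric.ball 0 1).indicator
    (fun _ => (volume (Metric.ball (0 : EuclideanSpace ℝ (Fin d)) 1))⁻¹)

/-- The autocorrelation measure `η⁺_p`, given by
`η⁺_p(f) = ∫ f(x - y) ρ(y) dM²_p(x, y)`. -/
def autocorrelation (P : Measure Ω) (p : Ω → Measure (EuclideanSpace ℝ (Fin d))) :
    Measure (EuclideanSpace ℝ (Fin d)) :=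
  ((secondMoment P p).withDensity (fun z => unitWeight d z.2)).map (fun z => z.1 - z.2)

/-- The centered autocorrelation `η_p(f) = η⁺_p(f) - i(p)² · Vol_d(f)`. It is a signed Radon
measure of possibly infinite total variation, hence is recorded as a functional on test
functions. -/
def centeredAutocorrelation (P : Measure Ω) (p : Ω → Measure (EuclideanSpace ℝ (Fin d)))
    (f : EuclideanSpace ℝ (Fin d) → ℂ) : ℂ :=
  (∫ x, f x ∂(autocorrelation P p)) - ((intensity P p : ℂ)) ^ 2 * ∫ x, f x

/-- `f ∗ f*`, where `f*(x) = conj (f (-x))`. -/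
def selfConvolution (f : EuclideanSpace ℝ (Fin d) → ℂ) : EuclideanSpace ℝ (Fin d) → ℂ :=
  f ⋆[ContinuousLinearMap.mul ℂ ℂ, volume] (fun x => (starRingEnd ℂ) (f (-x)))

/-- `μ` is the Fourier transform of the positive-definite signed Radon measure `η` on `ℝ^d`:
it is the positive Radon measure such that `μ(|f̂|²) = η(f ∗ f*)` for all `f ∈ C_c(ℝ^d)`, where
`f̂(ξ) = ∫ f(x) exp(-2πi⟨x, ξ⟩) dx`. -/
structure IsFourierTransformOf (μ : Measure (EuclideanSpace ℝ (Fin d)))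
    (η : (EuclideanSpace ℝ (Fin d) → ℂ) → ℂ) : Prop where
  locallyFinite : IsLocallyFiniteMeasure μ
  integrable : ∀ f : EuclideanSpace ℝ (Fin d) → ℂ, Continuous f → HasCompactSupport f →
    Integrable (fun ξ => ‖𝓕 f ξ‖ ^ 2) μ
  integral_eq : ∀ f : EuclideanSpace ℝ (Fin d) → ℂ, Continuous f → HasCompactSupport f →
    ((∫ ξ, ‖𝓕 f ξ‖ ^ 2 ∂μ : ℝ) : ℂ) = η (selfConvolution f)

/-- `μ` is the centered diffraction `η̂_p` of `p`: the Fourier transform of the centered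
autocorrelation. -/
def IsCenteredDiffraction (P : Measure Ω) (p : Ω → Measure (EuclideanSpace ℝ (Fin d)))
    (μ : Measure (EuclideanSpace ℝ (Fin d))) : Prop :=
  IsFourierTransformOf μ (centeredAutocorrelation P p)

/-- (Spectral) hyperuniformity: the centered diffraction satisfies `η̂_p(B_t) / t^d → 0` as
`t → 0⁺`, where `B_t` is the Euclidean ball of radius `t` about the origin. -/
def IsHyperuniform (P : Measure Ω) (p : Ω → Measure (EuclideanSpace ℝ (Fin d))) : Prop :=
  ∃ μ : Measure (EuclideanSpace ℝ (Fin d)), IsCenteredDiffraction P p μ ∧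
    Tendsto (fun t : ℝ => μ (Metric.ball 0 t) / ENNReal.ofReal (t ^ d)) (𝓝[>] 0) (𝓝 0)

end RandomMeasures

/-! ### Windows and lattices -/

/-- A Borel set `B ⊆ ℝ^d` is Fourier smooth with exponent `ϑ > 0` if
`|χ̂_B(ξ)| ≪ (1 + ‖ξ‖)^(-(d+ϑ)/2)`. -/
def IsFourierSmooth {d : ℕ} (B : Set (EuclideanSpace ℝ (Fin d))) (ϑ : ℝ) : Prop :=
  MeasurableSet B ∧ 0 < ϑ ∧ ∃ C : ℝ, ∀ ξ : EuclideanSpace ℝ (Fin d),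
    ‖𝓕 (B.indicator (fun _ => (1 : ℂ))) ξ‖ ≤ C * (1 + ‖ξ‖) ^ (-((d + ϑ) / 2))

section Lattices

variable {d₁ d₂ : ℕ}

/-- The dual lattice `Γ^⊥`: all `ξ` whose character `x ↦ exp(2πi⟨x, ξ⟩)` is trivial on `Γ`. -/
def dualLattice (Γ : Submodule ℤ (EuclideanSpace ℝ (Fin d₁) × EuclideanSpace ℝ (Fin d₂))) :
    Set (EuclideanSpace ℝ (Fin d₁) × EuclideanSpace ℝ (Fin d₂)) :=
  {ξ | ∀ γ ∈ Γ, Real.fourierChar (inner ℝ γ.1 ξ.1 + inner ℝ γ.2 ξ.2) = 1}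

/-- A lattice is `β`-repellent on the right if there is `ε₀ > 0` such that for all nonzero
`(γ₁, γ₂)` in it and all `ε < ε₀`: if `‖γ₁‖_∞ < ε`, then `‖γ₂‖_∞ ≥ ε^(-β)`. (The norm on
`Fin d → ℝ` is the supremum norm.) -/
def IsRepellentRight (L : Set (EuclideanSpace ℝ (Fin d₁) × EuclideanSpace ℝ (Fin d₂)))
    (β : ℝ) : Prop :=
  ∃ ε₀ : ℝ, 0 < ε₀ ∧ ∀ γ ∈ L, γ ≠ 0 → ∀ ε : ℝ, 0 < ε → ε < ε₀ →
    ‖WithLp.ofLp γ.1‖ < ε → ε ^ (-β) ≤ ‖WithLp.ofLp γ.2‖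

/-! ### Cut-and-project processes -/

/-- The torus `Ω = Γ \ (ℝ^{d₁} × ℝ^{d₂})`, with its quotient Borel structure. -/
abbrev CPTorus (Γ : Submodule ℤ (EuclideanSpace ℝ (Fin d₁) × EuclideanSpace ℝ (Fin d₂))) : Type :=
  (EuclideanSpace ℝ (Fin d₁) × EuclideanSpace ℝ (Fin d₂)) ⧸ Γ.toAddSubgroup

/-- The class of `(g, h)` in `Ω`. -/
abbrev CPTorus.mk (Γ : Submodule ℤ (EuclideanSpace ℝ (Fin d₁) × EuclideanSpace ℝ (Fin d₂)))
    (x : EuclideanSpace ℝ (Fin d₁) × EuclideanSpace ℝ (Fin d₂)) : CPTorus Γ :=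
  QuotientAddGroup.mk x

/-- A fundamental parallelepiped for the lattice `Γ`. -/
def cpDomain (Γ : Submodule ℤ (EuclideanSpace ℝ (Fin d₁) × EuclideanSpace ℝ (Fin d₂)))
    [DiscreteTopology Γ] [IsZLattice ℝ Γ] :
    Set (EuclideanSpace ℝ (Fin d₁) × EuclideanSpace ℝ (Fin d₂)) :=
  ZSpan.fundamentalDomain ((Module.Free.chooseBasis ℤ Γ).ofZLatticeBasis ℝ)

/-- The invariant probability measure on `Ω`: the push-forward of normalized Lebesgue measure on
a fundamental domain. -/
def cpProb (Γ : Submodule ℤ (EuclideanSpace ℝ (Fin d₁) × EuclideanSpace ℝ (Fin d₂)))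
    [DiscreteTopology Γ] [IsZLattice ℝ Γ] : Measure (CPTorus Γ) :=
  ((volume (cpDomain Γ))⁻¹ • volume.restrict (cpDomain Γ)).map (CPTorus.mk Γ)

/-- The cut-and-project set `Λ(ℝ^{d₁}, ℝ^{d₂}, Γ, W) = pr₁(Γ ∩ (ℝ^{d₁} × W))`. -/
def cpSet (Γ : Submodule ℤ (EuclideanSpace ℝ (Fin d₁) × EuclideanSpace ℝ (Fin d₂)))
    (W : Set (EuclideanSpace ℝ (Fin d₂))) : Set (EuclideanSpace ℝ (Fin d₁)) :=
  Prod.fst '' ((Γ : Set (EuclideanSpace ℝ (Fin d₁) × EuclideanSpace ℝ (Fin d₂))) ∩ univ ×ˢ W)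

/-- The set `Λ_ω` for `ω ∈ Ω`, written without reference to a representative of `ω`;
`cpRandomSet_mk` gives the usual formula in terms of a representative. -/
def cpRandomSet (Γ : Submodule ℤ (EuclideanSpace ℝ (Fin d₁) × EuclideanSpace ℝ (Fin d₂)))
    (W : Set (EuclideanSpace ℝ (Fin d₂))) (ω : CPTorus Γ) : Set (EuclideanSpace ℝ (Fin d₁)) :=
  {x | ∃ w ∈ W, CPTorus.mk Γ (x, w) = ω}

/-- `Λ_{Γ(g,h)} = Λ(ℝ^{d₁}, ℝ^{d₂}, Γ, W - h) + g`. -/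
theorem cpRandomSet_mk (Γ : Submodule ℤ (EuclideanSpace ℝ (Fin d₁) × EuclideanSpace ℝ (Fin d₂)))
    (W : Set (EuclideanSpace ℝ (Fin d₂))) (g : EuclideanSpace ℝ (Fin d₁))
    (h : EuclideanSpace ℝ (Fin d₂)) :
    cpRandomSet Γ W (CPTorus.mk Γ (g, h)) =
      (fun x => x + g) '' cpSet Γ ((fun w => w - h) '' W) := by
  ext x
  simp only [cpRandomSet, cpSet, mem_ofPred_eq, mem_image, mem_inter_iff, mem_prod, mem_univ,
    true_and, SetLike.mem_coe]
  constructor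
  · rintro ⟨w, hw, hx⟩
    have hx' := QuotientAddGroup.eq.1 hx.symm
    refine ⟨x - g, ⟨(x - g, w - h), ⟨?_, w, hw, rfl⟩, rfl⟩, by abel⟩
    have e : (x - g, w - h) = -(g, h) + (x, w) := by
      ext1 <;> simp [sub_eq_neg_add]
    rw [e]
    exact hx'
  · rintro ⟨y, ⟨⟨a, b⟩, ⟨hab, w, hw, hb⟩, rfl⟩, rfl⟩
    refine ⟨w, hw, (QuotientAddGroup.eq.2 ?_).symm⟩
    have e : -(g, h) + (a + g, w) = (a, b) := by
      ext1
      · simp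
      · change -h + w = b
        have hb' : w - h = b := hb
        rw [← hb', sub_eq_neg_add]
    change -(g, h) + (a + g, w) ∈ Γ
    rw [e]
    exact hab

/-- The cut-and-project process `p(ℝ^{d₁}, ℝ^{d₂}, Γ, W) : ω ↦ δ_{Λ_ω} = ∑_{x ∈ Λ_ω} δ_x`. -/
def cpProcess (Γ : Submodule ℤ (EuclideanSpace ℝ (Fin d₁) × EuclideanSpace ℝ (Fin d₂)))
    (W : Set (EuclideanSpace ℝ (Fin d₂))) (ω : CPTorus Γ) : Measure (EuclideanSpace ℝ (Fin d₁)) :=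
  Measure.sum (fun x : cpRandomSet Γ W ω => Measure.dirac (x : EuclideanSpace ℝ (Fin d₁)))

/-- Lebesgue measure on `ℝ^{d₁} × ℝ^{d₂}` is a Haar measure. -/
theorem isAddHaar_volume_prod : (volume :
    Measure (EuclideanSpace ℝ (Fin d₁) × EuclideanSpace ℝ (Fin d₂))).IsAddHaarMeasure :=
  inferInstanceAs (Measure.IsAddHaarMeasure
    ((volume : Measure (EuclideanSpace ℝ (Fin d₁))).prod
      (volume : Measure (EuclideanSpace ℝ (Fin d₂)))))

/-- `cpProb Γ` is a probability measure. -/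
theorem isProbabilityMeasure_cpProb
    (Γ : Submodule ℤ (EuclideanSpace ℝ (Fin d₁) × EuclideanSpace ℝ (Fin d₂)))
    [DiscreteTopology Γ] [IsZLattice ℝ Γ] : IsProbabilityMeasure (cpProb Γ) := by
  have hm : Measurable (CPTorus.mk Γ) := measurable_quotient_mk''
  have := isAddHaar_volume_prod (d₁ := d₁) (d₂ := d₂)
  constructor
  rw [cpProb, Measure.map_apply hm MeasurableSet.univ]
  simp only [preimage_univ, Measure.smul_apply, Measure.restrict_apply MeasurableSet.univ,
    univ_inter, smul_eq_mul]
  refine ENNReal.inv_mul_cancel ?_ ?_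
  · exact ZSpan.measure_fundamentalDomain_ne_zero _
  · exact (ZSpan.fundamentalDomain_isBounded _).measure_lt_top.ne

section Invariance

open scoped Pointwise

/-- `cpProb Γ` is invariant under all translations of the torus, in particular under `ℝ^{d₁}`. -/
theorem cpProb_map_add
    (Γ : Submodule ℤ (EuclideanSpace ℝ (Fin d₁) × EuclideanSpace ℝ (Fin d₂)))
    [DiscreteTopology Γ] [IsZLattice ℝ Γ]
    (x : EuclideanSpace ℝ (Fin d₁) × EuclideanSpace ℝ (Fin d₂)) :
    (cpProb Γ).map (fun ω => CPTorus.mk Γ x + ω) = cpProb Γ := by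
  have hm : Measurable (CPTorus.mk Γ) := measurable_quotient_mk''
  have := isAddHaar_volume_prod (d₁ := d₁) (d₂ := d₂)
  have hfd : IsAddFundamentalDomain Γ.toAddSubgroup (cpDomain Γ) volume :=
    ZLattice.isAddFundamentalDomain (Module.Free.chooseBasis ℤ Γ) volume
  have hfd' : IsAddFundamentalDomain Γ.toAddSubgroup (x +ᵥ cpDomain Γ) volume :=
    hfd.vadd_of_comm x
  have hadd : Measurable (fun ω : CPTorus Γ => CPTorus.mk Γ x + ω) := by
    refine measurable_from_quotient.2 ?_
    exact hm.comp (measurable_const_add x)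
  have key : ∀ B : Set (CPTorus Γ), MeasurableSet B →
      cpProb Γ B = (volume (cpDomain Γ))⁻¹ * volume (CPTorus.mk Γ ⁻¹' B ∩ cpDomain Γ) := by
    intro B hB
    rw [cpProb, Measure.map_apply hm hB, Measure.smul_apply, Measure.restrict_apply (hm hB),
      smul_eq_mul]
  ext A hA
  rw [Measure.map_apply hadd hA, key _ (hadd hA), key _ hA]
  congr 1
  have hpre : CPTorus.mk Γ ⁻¹' ((fun ω : CPTorus Γ => CPTorus.mk Γ x + ω) ⁻¹' A) ∩ cpDomain Γ =
      (fun y => x + y) ⁻¹' (CPTorus.mk Γ ⁻¹' A ∩ (x +ᵥ cpDomain Γ)) := by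
    ext y
    simp only [mem_inter_iff, mem_preimage]
    refine and_congr Iff.rfl ?_
    exact (Set.vadd_mem_vadd_set_iff (a := x) (s := cpDomain Γ) (x := y)).symm
  have hcount : Countable Γ.toAddSubgroup := inferInstanceAs (Countable Γ)
  rw [hpre, measure_preimage_add]
  refine hfd'.measure_set_eq hfd (hm hA) fun γ => ?_
  ext y
  simp only [mem_preimage]
  have : CPTorus.mk Γ (γ +ᵥ y) = CPTorus.mk Γ y := by
    refine (QuotientAddGroup.eq.2 ?_).symm
    have e : -y + (γ +ᵥ y) = (γ : EuclideanSpace ℝ (Fin d₁) × EuclideanSpace ℝ (Fin d₂)) := by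
      change -y + ((γ : EuclideanSpace ℝ (Fin d₁) × EuclideanSpace ℝ (Fin d₂)) + y) = _
      abel
    rw [e]
    exact γ.2
  rw [this]

end Invariance

end Lattices

end

/-! For a test function `f`, the linear statistic `ω ↦ ∫ f dp_ω` is the `Γ`-periodization of `f ⊗
χ_W`. Unfolding over a fundamental domain therefore gives its Fourier coefficient at `ξ = (ξ₁, ξ₂) ∈
Γ^⊥` as `covol(Γ)⁻¹ · f̂(ξ₁) · χ̂_W(ξ₂)` (`integral_cpDomain_negCharacter`). Its second moment is
`η⁺(f ∗ f*)` (`memLp_and_integral_norm_sq_linear_statistic`), so Parseval on the torus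
(`hasSum_sq_norm_integral_fundamentalDomain`) turns the autocorrelation into a sum over `Γ^⊥`. The
term at `ξ = 0` is `i(p)² |f̂(0)|²`, which is what centering subtracts. Hence the centered
diffraction is the pure point measure `∑_{ξ ≠ 0} covol(Γ)⁻² |χ̂_W(ξ₂)|² δ_{ξ₁}`
(`isCenteredDiffraction_cpDiffraction`). It is unique because polarization recovers the
characteristic functions of the finite measures `|ĝ|² μ` from the values `μ(|f̂|²)`
(`IsFourierTransformOf.unique`).

For the decay at `0`, take the nonzero `ξ ∈ Γ^⊥` with `‖ξ₁‖ < ε`. These points and their differences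
are dual lattice vectors with first coordinate smaller than `2ε`, so repellence makes the `ξ₂` stay
at distance at least `r = (2ε)^(-β)` from `0` and from each other. Fourier smoothness bounds the
masses by a multiple of `(1 + ‖ξ₂‖)^(-(d₂+ϑ))`, and the sum of such terms over an `r`-separated set
is `O(r^(-(d₂+ϑ)))` (`exists_tsum_separated_le`), that is `O(ε^(β(d₂+ϑ)))`
(`exists_cpDiffraction_ball_le`). -/

noncomputable section

/-! ### The process as a weighted sum over the lattice -/

section Lattices

variable {d₁ d₂ : ℕ}
  {Γ : Submodule ℤ (EuclideanSpace ℝ (Fin d₁) × EuclideanSpace ℝ (Fin d₂))}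
  {W : Set (EuclideanSpace ℝ (Fin d₂))}

theorem measurable_cpTorus_mk : Measurable (CPTorus.mk Γ) := measurable_quotient_mk''

/-- The indicator function of the window, with values in `ℝ≥0∞`. -/
abbrev windowIndicator (W : Set (EuclideanSpace ℝ (Fin d₂))) (h : EuclideanSpace ℝ (Fin d₂)) :
    ℝ≥0∞ := W.indicator 1 h

theorem cpTorus_mk_add (x : EuclideanSpace ℝ (Fin d₁) × EuclideanSpace ℝ (Fin d₂)) (γ : Γ) :
    CPTorus.mk Γ (x + γ.1) = CPTorus.mk Γ x := by
  refine (QuotientAddGroup.eq.2 ?_).symm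
  rw [neg_add_cancel_left]
  exact γ.2

theorem cpTorus_mk_eq_iff {x y : EuclideanSpace ℝ (Fin d₁) × EuclideanSpace ℝ (Fin d₂)} :
    CPTorus.mk Γ y = CPTorus.mk Γ x ↔ ∃ γ : Γ, y = x + γ.1 := by
  constructor
  · intro h
    exact ⟨⟨-x + y, QuotientAddGroup.eq.1 h.symm⟩, by simp⟩
  · rintro ⟨γ, rfl⟩
    exact cpTorus_mk_add x γ

/-- The points of `Λ_{Γx}` are indexed by the lattice points over the window. -/
def cpRandomSetEquiv (hinj : Set.InjOn Prod.fst
      (Γ : Set (EuclideanSpace ℝ (Fin d₁) × EuclideanSpace ℝ (Fin d₂))))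
    (W : Set (EuclideanSpace ℝ (Fin d₂)))
    (x : EuclideanSpace ℝ (Fin d₁) × EuclideanSpace ℝ (Fin d₂)) :
    {γ : Γ | x.2 + γ.1.2 ∈ W} ≃ cpRandomSet Γ W (CPTorus.mk Γ x) :=
  Equiv.ofBijective
    (fun γ => ⟨x.1 + γ.1.1.1, x.2 + γ.1.1.2, γ.2, cpTorus_mk_add x γ.1⟩) <| by
    constructor
    · intro γ γ' h
      have h1 : γ.1.1.1 = γ'.1.1.1 := add_left_cancel (congrArg Subtype.val h)
      exact Subtype.ext (Subtype.ext (hinj γ.1.2 γ'.1.2 h1))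
    · rintro ⟨y, w, hw, hy⟩
      obtain ⟨γ, hγ⟩ := cpTorus_mk_eq_iff.1 hy
      have h1 : y = x.1 + γ.1.1 := congrArg Prod.fst hγ
      have h2 : w = x.2 + γ.1.2 := congrArg Prod.snd hγ
      exact ⟨⟨γ, by simpa [← h2] using hw⟩, Subtype.ext h1.symm⟩

/-- The index set is all of `Γ`, independent of `x`; the window enters only through the weights.
Measurability and unfolding can then be done term by term. Injectivity of the projection ensures
that no point is counted twice. -/
theorem cpProcess_mk (hinj : Set.InjOn Prod.fst
      (Γ : Set (EuclideanSpace ℝ (Fin d₁) × EuclideanSpace ℝ (Fin d₂))))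
    (W : Set (EuclideanSpace ℝ (Fin d₂)))
    (x : EuclideanSpace ℝ (Fin d₁) × EuclideanSpace ℝ (Fin d₂)) :
    cpProcess Γ W (CPTorus.mk Γ x) =
      Measure.sum fun γ : Γ => windowIndicator W (x.2 + γ.1.2) • Measure.dirac (x.1 + γ.1.1) := by
  ext A hA
  rw [cpProcess, Measure.sum_apply _ hA, Measure.sum_apply _ hA,
    ← (cpRandomSetEquiv hinj W x).tsum_eq]
  refine (tsum_subtype {γ : Γ | x.2 + γ.1.2 ∈ W}
    (fun γ => Measure.dirac (x.1 + γ.1.1) A)).trans ?_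
  refine tsum_congr fun γ => ?_
  by_cases h : x.2 + γ.1.2 ∈ W <;> simp [windowIndicator, h]

theorem measurable_cpProcess [Countable Γ] (hinj : Set.InjOn Prod.fst
      (Γ : Set (EuclideanSpace ℝ (Fin d₁) × EuclideanSpace ℝ (Fin d₂))))
    (hW : MeasurableSet W) : Measurable (cpProcess Γ W) := by
  refine measurable_from_quotient.2 (Measure.measurable_of_measurable_coe _ fun A hA => ?_)
  change Measurable fun x => cpProcess Γ W (CPTorus.mk Γ x) A
  simp_rw [cpProcess_mk hinj, Measure.sum_apply _ hA, Measure.smul_apply,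
    Measure.dirac_apply' _ hA, smul_eq_mul]
  refine Measurable.tsum fun γ => ?_
  have h1 : Measurable (windowIndicator W) := measurable_one.indicator hW
  have h2 : Measurable (A.indicator (fun _ => (1 : ℝ≥0∞))) := measurable_const.indicator hA
  exact (h1.comp (measurable_snd.add_const _)).mul (h2.comp (measurable_fst.add_const _))

theorem cpProcess_prod_mk [Countable Γ] (hinj : Set.InjOn Prod.fst
      (Γ : Set (EuclideanSpace ℝ (Fin d₁) × EuclideanSpace ℝ (Fin d₂))))
    (W : Set (EuclideanSpace ℝ (Fin d₂)))
    (x : EuclideanSpace ℝ (Fin d₁) × EuclideanSpace ℝ (Fin d₂)) :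
    (cpProcess Γ W (CPTorus.mk Γ x)).prod (cpProcess Γ W (CPTorus.mk Γ x)) =
      Measure.sum fun γ : Γ × Γ =>
        (windowIndicator W (x.2 + γ.1.1.2) * windowIndicator W (x.2 + γ.2.1.2)) •
          Measure.dirac (x.1 + γ.1.1.1, x.1 + γ.2.1.1) := by
  have hlt : ∀ γ : Γ, windowIndicator W (x.2 + γ.1.2) ≠ ∞ := fun γ => by
    by_cases h : x.2 + γ.1.2 ∈ W <;> simp [windowIndicator, h]
  have : ∀ γ : Γ, SFinite
      (windowIndicator W (x.2 + γ.1.2) • Measure.dirac (x.1 + γ.1.1)) := fun γ => inferInstance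
  rw [cpProcess_mk hinj, Measure.prod_sum]
  congr 1
  ext1 γ
  rw [Measure.prod_smul_left, Measure.prod_smul_right, Measure.dirac_prod_dirac, smul_smul]

theorem sFinite_cpProcess [Countable Γ] (hinj : Set.InjOn Prod.fst
      (Γ : Set (EuclideanSpace ℝ (Fin d₁) × EuclideanSpace ℝ (Fin d₂)))) (ω : CPTorus Γ) :
    SFinite (cpProcess Γ W ω) := by
  obtain ⟨x, rfl⟩ := QuotientAddGroup.mk_surjective ω
  rw [show (QuotientAddGroup.mk x : CPTorus Γ) = CPTorus.mk Γ x from rfl, cpProcess_mk hinj]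
  infer_instance

theorem measurable_cpProcess_prod [Countable Γ] (hinj : Set.InjOn Prod.fst
      (Γ : Set (EuclideanSpace ℝ (Fin d₁) × EuclideanSpace ℝ (Fin d₂))))
    (hW : MeasurableSet W) :
    Measurable fun ω => (cpProcess Γ W ω).prod (cpProcess Γ W ω) := by
  refine measurable_from_quotient.2 (Measure.measurable_of_measurable_coe _ fun A hA => ?_)
  change Measurable fun x => (cpProcess Γ W (CPTorus.mk Γ x)).prod
    (cpProcess Γ W (CPTorus.mk Γ x)) A
  simp_rw [cpProcess_prod_mk hinj, Measure.sum_apply _ hA, Measure.smul_apply,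
    Measure.dirac_apply' _ hA, smul_eq_mul]
  refine Measurable.tsum fun γ => ?_
  have h1 : Measurable (windowIndicator W) := measurable_one.indicator hW
  have h2 : Measurable (A.indicator (fun _ => (1 : ℝ≥0∞))) := measurable_const.indicator hA
  exact ((h1.comp (measurable_snd.add_const _)).mul (h1.comp (measurable_snd.add_const _))).mul
    (h2.comp ((measurable_fst.add_const _).prodMk (measurable_fst.add_const _)))

theorem lintegral_cpProcess_mk (hinj : Set.InjOn Prod.fst
      (Γ : Set (EuclideanSpace ℝ (Fin d₁) × EuclideanSpace ℝ (Fin d₂))))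
    (x : EuclideanSpace ℝ (Fin d₁) × EuclideanSpace ℝ (Fin d₂))
    {φ : EuclideanSpace ℝ (Fin d₁) → ℝ≥0∞} (hφ : Measurable φ) :
    ∫⁻ y, φ y ∂(cpProcess Γ W (CPTorus.mk Γ x)) =
      ∑' γ : Γ, windowIndicator W (x.2 + γ.1.2) * φ (x.1 + γ.1.1) := by
  rw [cpProcess_mk hinj, lintegral_sum_measure]
  refine tsum_congr fun γ => ?_
  rw [lintegral_smul_measure, lintegral_dirac' _ hφ, smul_eq_mul]

theorem lintegral_cpProcess_prod_mk [Countable Γ] (hinj : Set.InjOn Prod.fst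
      (Γ : Set (EuclideanSpace ℝ (Fin d₁) × EuclideanSpace ℝ (Fin d₂))))
    (x : EuclideanSpace ℝ (Fin d₁) × EuclideanSpace ℝ (Fin d₂))
    {φ : EuclideanSpace ℝ (Fin d₁) × EuclideanSpace ℝ (Fin d₁) → ℝ≥0∞} (hφ : Measurable φ) :
    ∫⁻ y, φ y ∂(cpProcess Γ W (CPTorus.mk Γ x)).prod (cpProcess Γ W (CPTorus.mk Γ x)) =
      ∑' γ : Γ, ∑' δ : Γ, windowIndicator W (x.2 + γ.1.2) *
        windowIndicator W (x.2 + γ.1.2 + δ.1.2) * φ (x.1 + γ.1.1, x.1 + γ.1.1 + δ.1.1) := by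
  rw [cpProcess_prod_mk hinj, lintegral_sum_measure, ENNReal.tsum_prod']
  refine tsum_congr fun γ => ?_
  -- The second point is recorded by its difference `δ` from the first. For fixed `δ` the sum over
  -- `γ` is then a sum of translates of one function of `x`, ready for unfolding.
  rw [← (Equiv.addLeft γ).tsum_eq]
  refine tsum_congr fun δ => ?_
  rw [lintegral_smul_measure, lintegral_dirac' _ hφ, smul_eq_mul]
  simp [add_assoc]

/-! ### Unfolding, moment measures and autocorrelation -/

section Unfolding

variable [DiscreteTopology Γ] [IsZLattice ℝ Γ]

theorem isAddFundamentalDomain_cpDomain :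
    IsAddFundamentalDomain Γ.toAddSubgroup (cpDomain Γ) (volume : Measure
      (EuclideanSpace ℝ (Fin d₁) × EuclideanSpace ℝ (Fin d₂))) :=
  ZLattice.isAddFundamentalDomain (Module.Free.chooseBasis ℤ Γ) volume

theorem cpProb_def' : cpProb Γ = (volume (cpDomain Γ))⁻¹ •
    (volume.restrict (cpDomain Γ)).map (CPTorus.mk Γ) := by
  rw [cpProb, Measure.map_smul]

theorem lintegral_cpProb {F : CPTorus Γ → ℝ≥0∞} (hF : Measurable F) :
    ∫⁻ ω, F ω ∂cpProb Γ =
      (volume (cpDomain Γ))⁻¹ * ∫⁻ x in cpDomain Γ, F (CPTorus.mk Γ x) := by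
  rw [cpProb_def', lintegral_smul_measure, lintegral_map hF measurable_cpTorus_mk, smul_eq_mul]

theorem volume_cpDomain_ne_zero : volume (cpDomain Γ) ≠ 0 := by
  have := isAddHaar_volume_prod (d₁ := d₁) (d₂ := d₂)
  exact ZSpan.measure_fundamentalDomain_ne_zero _

/-- The `Γ`-translates of the fundamental domain tile the space up to null sets. -/
theorem setLIntegral_cpDomain_tsum
    {ψ : EuclideanSpace ℝ (Fin d₁) × EuclideanSpace ℝ (Fin d₂) → ℝ≥0∞} (hψ : Measurable ψ) :
    ∫⁻ x in cpDomain Γ, ∑' γ : Γ, ψ (x + γ.1) = ∫⁻ x, ψ x := by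
  have := isAddHaar_volume_prod (d₁ := d₁) (d₂ := d₂)
  have : Countable Γ.toAddSubgroup := inferInstanceAs (Countable Γ)
  have hm : ∀ γ : Γ, AEMeasurable (fun x => ψ (x + γ.1)) (volume.restrict (cpDomain Γ)) :=
    fun γ => (hψ.comp (measurable_add_const γ.1)).aemeasurable
  rw [lintegral_tsum hm,
    (isAddFundamentalDomain_cpDomain (Γ := Γ)).lintegral_eq_tsum'' ψ]
  refine tsum_congr fun γ => lintegral_congr fun x => ?_
  rw [add_comm]
  rfl

/-- The density of pairs of points of the process with difference `-γ.1`. -/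
def pairDensity (Γ : Submodule ℤ (EuclideanSpace ℝ (Fin d₁) × EuclideanSpace ℝ (Fin d₂)))
    [DiscreteTopology Γ] [IsZLattice ℝ Γ] (W : Set (EuclideanSpace ℝ (Fin d₂))) (γ : Γ) : ℝ≥0∞ :=
  (volume (cpDomain Γ))⁻¹ * volume (W ∩ (fun h => h + γ.1.2) ⁻¹' W)

/-- Campbell's formula: unfolding leaves the integral of `χ_W ⊗ φ` over the whole space, which
factors. -/
theorem lintegral_firstMoment_cpProcess (hinj : Set.InjOn Prod.fst
      (Γ : Set (EuclideanSpace ℝ (Fin d₁) × EuclideanSpace ℝ (Fin d₂))))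
    (hW : MeasurableSet W) {φ : EuclideanSpace ℝ (Fin d₁) → ℝ≥0∞} (hφ : Measurable φ) :
    ∫⁻ y, φ y ∂firstMoment (cpProb Γ) (cpProcess Γ W) =
      (volume (cpDomain Γ))⁻¹ * volume W * ∫⁻ y, φ y := by
  have hp := measurable_cpProcess (Γ := Γ) hinj hW
  have h1 : Measurable (windowIndicator W) := measurable_one.indicator hW
  rw [firstMoment, Measure.lintegral_bind hp.aemeasurable hφ.aemeasurable,
    lintegral_cpProb (F := fun ω => ∫⁻ x, φ x ∂(cpProcess Γ W ω))
      ((Measure.measurable_lintegral hφ).comp hp), mul_assoc]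
  congr 1
  simp_rw [lintegral_cpProcess_mk hinj _ hφ]
  have key := setLIntegral_cpDomain_tsum (Γ := Γ)
    (ψ := fun x => windowIndicator W x.2 * φ x.1)
    ((h1.comp measurable_snd).mul (hφ.comp measurable_fst))
  simp only [Prod.fst_add, Prod.snd_add] at key
  rw [key, Measure.volume_eq_prod]
  simp_rw [mul_comm (windowIndicator W _)]
  rw [lintegral_prod_mul hφ.aemeasurable h1.aemeasurable, mul_comm]
  simp [windowIndicator, lintegral_indicator_one hW]

theorem intensity_cpProcess (hinj : Set.InjOn Prod.fst
      (Γ : Set (EuclideanSpace ℝ (Fin d₁) × EuclideanSpace ℝ (Fin d₂))))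
    (hW : MeasurableSet W) :
    intensity (cpProb Γ) (cpProcess Γ W) =
      (volume (cpDomain Γ)).toReal⁻¹ * (volume W).toReal := by
  have hB : MeasurableSet (Metric.ball (0 : EuclideanSpace ℝ (Fin d₁)) 1) := measurableSet_ball
  have := lintegral_firstMoment_cpProcess (Γ := Γ) hinj hW
    (φ := (Metric.ball 0 1).indicator 1) (measurable_one.indicator hB)
  rw [lintegral_indicator_one hB, lintegral_indicator_one hB] at this
  rw [intensity, this, ENNReal.mul_div_cancel_right
    (Metric.measure_ball_pos _ _ one_pos).ne' measure_ball_lt_top.ne, ENNReal.toReal_mul,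
    ENNReal.toReal_inv]

theorem lintegral_secondMoment_cpProcess (hinj : Set.InjOn Prod.fst
      (Γ : Set (EuclideanSpace ℝ (Fin d₁) × EuclideanSpace ℝ (Fin d₂))))
    (hW : MeasurableSet W)
    {φ : EuclideanSpace ℝ (Fin d₁) × EuclideanSpace ℝ (Fin d₁) → ℝ≥0∞} (hφ : Measurable φ) :
    ∫⁻ y, φ y ∂secondMoment (cpProb Γ) (cpProcess Γ W) =
      ∑' γ : Γ, pairDensity Γ W γ * ∫⁻ y, φ (y, y + γ.1.1) := by
  have hp := measurable_cpProcess_prod (Γ := Γ) hinj hW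
  have h1 : Measurable (windowIndicator W) := measurable_one.indicator hW
  have h2 : ∀ γ : Γ, Measurable fun x : EuclideanSpace ℝ (Fin d₁) × EuclideanSpace ℝ (Fin d₂) =>
      windowIndicator W x.2 * windowIndicator W (x.2 + γ.1.2) * φ (x.1, x.1 + γ.1.1) := fun γ =>
    ((h1.comp measurable_snd).mul (h1.comp (measurable_snd.add_const _))).mul
      (hφ.comp (measurable_fst.prodMk (measurable_fst.add_const _)))
  rw [secondMoment, Measure.lintegral_bind hp.aemeasurable hφ.aemeasurable,
    lintegral_cpProb (F := fun ω => ∫⁻ x, φ x ∂(cpProcess Γ W ω).prod (cpProcess Γ W ω))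
      ((Measure.measurable_lintegral hφ).comp hp)]
  simp_rw [lintegral_cpProcess_prod_mk hinj _ hφ]
  have key := setLIntegral_cpDomain_tsum (Γ := Γ) (ψ := fun x => ∑' δ : Γ, windowIndicator W x.2 *
    windowIndicator W (x.2 + δ.1.2) * φ (x.1, x.1 + δ.1.1)) (.tsum h2)
  simp only [Prod.fst_add, Prod.snd_add] at key
  rw [key, lintegral_tsum fun γ => (h2 γ).aemeasurable, ← ENNReal.tsum_mul_left]
  refine tsum_congr fun γ => ?_
  rw [pairDensity, mul_assoc, Measure.volume_eq_prod]
  simp_rw [mul_comm (windowIndicator W _ * _)]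
  rw [lintegral_prod_mul (f := fun x => φ (x, x + γ.1.1))
    (g := fun h => windowIndicator W h * windowIndicator W (h + γ.1.2))
    (hφ.comp (measurable_id.prodMk (measurable_id.add_const _))).aemeasurable
    (h1.mul (h1.comp (measurable_add_const _))).aemeasurable, mul_comm (lintegral _ _)]
  congr 2
  rw [← lintegral_indicator_one (hW.inter (measurable_add_const _ hW))]
  refine lintegral_congr fun h => ?_
  rw [inter_indicator_one]
  rfl

/-- The second moment measure as a sum of Lebesgue measures on translates of the diagonal. -/
theorem secondMoment_cpProcess (hinj : Set.InjOn Prod.fst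
      (Γ : Set (EuclideanSpace ℝ (Fin d₁) × EuclideanSpace ℝ (Fin d₂))))
    (hW : MeasurableSet W) :
    secondMoment (cpProb Γ) (cpProcess Γ W) =
      Measure.sum fun γ : Γ => pairDensity Γ W γ • volume.map fun y => (y, y + γ.1.1) := by
  refine Measure.ext_of_lintegral _ fun φ hφ => ?_
  rw [lintegral_secondMoment_cpProcess hinj hW hφ, lintegral_sum_measure]
  refine tsum_congr fun γ => ?_
  rw [lintegral_smul_measure, lintegral_map hφ (by fun_prop), smul_eq_mul]

theorem lintegral_unitWeight (d : ℕ) : ∫⁻ y, unitWeight d y = 1 := by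
  rw [unitWeight, lintegral_indicator measurableSet_ball, setLIntegral_const]
  exact ENNReal.inv_mul_cancel (Metric.measure_ball_pos _ _ one_pos).ne' measure_ball_lt_top.ne

theorem measurable_unitWeight (d : ℕ) : Measurable (unitWeight d) :=
  measurable_const.indicator measurableSet_ball

/-- The autocorrelation of a cut-and-project process is a weighted Dirac comb. -/
theorem autocorrelation_cpProcess (hinj : Set.InjOn Prod.fst
      (Γ : Set (EuclideanSpace ℝ (Fin d₁) × EuclideanSpace ℝ (Fin d₂))))
    (hW : MeasurableSet W) :
    autocorrelation (cpProb Γ) (cpProcess Γ W) =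
      Measure.sum fun γ : Γ => pairDensity Γ W γ • Measure.dirac (-γ.1.1) := by
  refine Measure.ext_of_lintegral _ fun φ hφ => ?_
  have hu := measurable_unitWeight d₁
  rw [autocorrelation, lintegral_map hφ (by fun_prop),
    lintegral_withDensity_eq_lintegral_mul _ (by fun_prop) (by fun_prop),
    lintegral_secondMoment_cpProcess hinj hW (by fun_prop), lintegral_sum_measure]
  refine tsum_congr fun γ => ?_
  rw [lintegral_smul_measure, lintegral_dirac' _ hφ, smul_eq_mul]
  congr 1
  -- On the pairs `(y, y + γ₁)` the difference is constantly `-γ₁`, so only the weight `ρ` is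
  -- integrated, and its integral is one.
  simp only [Pi.mul_apply, sub_add_cancel_left]
  rw [lintegral_mul_const _ (by fun_prop), lintegral_add_right_eq_self (unitWeight d₁),
    lintegral_unitWeight, one_mul]

end Unfolding

end Lattices

/-! ### Bochner integrals against averaged measures -/

section BindIntegral

variable {α β : Type*} [MeasurableSpace α] [MeasurableSpace β]

theorem integrable_and_integral_bind {P : Measure α} {κ : α → Measure β} (hκ : Measurable κ)
    {f : β → ℂ} (hf : Integrable f (P.bind κ)) :
    Integrable (fun a => ∫ b, f b ∂κ a) P ∧ ∫ b, f b ∂P.bind κ = ∫ a, ∫ b, f b ∂κ a ∂P := by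
  have h : P.bind κ = ((⟨κ, hκ⟩ : ProbabilityTheory.Kernel α β).comp
      (ProbabilityTheory.Kernel.const Unit P)) () := by
    rw [ProbabilityTheory.Kernel.comp_apply, ProbabilityTheory.Kernel.const_apply]
    rfl
  rw [h] at hf
  refine ⟨by simpa using! hf.integral_comp, ?_⟩
  rw [h, ProbabilityTheory.Kernel.integral_comp hf]
  simp

end BindIntegral

/-! ### Linear statistics: second moments and Fourier coefficients -/

section Lattices

variable {d₁ d₂ : ℕ}
  {Γ : Submodule ℤ (EuclideanSpace ℝ (Fin d₁) × EuclideanSpace ℝ (Fin d₂))}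
  {W : Set (EuclideanSpace ℝ (Fin d₂))} [DiscreteTopology Γ] [IsZLattice ℝ Γ]

omit [IsZLattice ℝ Γ] in
theorem finite_lattice_inter_bounded
    {s : Set (EuclideanSpace ℝ (Fin d₁) × EuclideanSpace ℝ (Fin d₂))}
    (hs : Bornology.IsBounded s) : {γ : Γ | γ.1 ∈ s}.Finite := by
  have hc : IsClosed (Γ.toAddSubgroup :
      Set (EuclideanSpace ℝ (Fin d₁) × EuclideanSpace ℝ (Fin d₂))) := by
    have : DiscreteTopology Γ.toAddSubgroup := inferInstanceAs (DiscreteTopology Γ)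
    exact AddSubgroup.isClosed_of_discrete
  have := Metric.finite_isBounded_inter_isClosed (K := s)
    (s := (Γ : Set (EuclideanSpace ℝ (Fin d₁) × EuclideanSpace ℝ (Fin d₂))))
    (DiscreteTopology.isDiscrete) hs hc
  refine Set.Finite.of_finite_image (this.subset ?_) Subtype.val_injective.injOn
  rintro _ ⟨γ, hγ, rfl⟩
  exact ⟨hγ, γ.2⟩

theorem pairDensity_ne_top (hWb : Bornology.IsBounded W) (γ : Γ) : pairDensity Γ W γ ≠ ∞ :=
  ENNReal.mul_ne_top (ENNReal.inv_ne_top.2 volume_cpDomain_ne_zero)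
    (hWb.subset inter_subset_left).measure_lt_top.ne

/-- Only finitely many terms survive: `W` must meet its translate by `γ₂` and the support of `f` its
translate by `γ₁`, which confines `γ` to a bounded set. -/
theorem tsum_pairDensity_mul_lt_top (hWb : Bornology.IsBounded W)
    {f : EuclideanSpace ℝ (Fin d₁) → ℂ} (hf : Continuous f) (hfc : HasCompactSupport f) :
    ∑' γ : Γ, pairDensity Γ W γ * ∫⁻ y, ‖f y * (starRingEnd ℂ) (f (y + γ.1.1))‖ₑ < ∞ := by
  obtain ⟨R, hR⟩ := hWb.subset_closedBall 0
  obtain ⟨S, hS⟩ := hfc.isCompact.isBounded.subset_closedBall 0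
  have hfin := finite_lattice_inter_bounded (Γ := Γ)
    (Metric.isBounded_closedBall (x := 0) (r := S + S) |>.prod
      (Metric.isBounded_closedBall (x := 0) (r := R + R)))
  rw [tsum_eq_sum (s := hfin.toFinset)]
  · refine ENNReal.sum_lt_top.2 fun γ _ => ENNReal.mul_lt_top (pairDensity_ne_top hWb γ).lt_top ?_
    have hi : Integrable (fun y => f y * (starRingEnd ℂ) (f (y + γ.1.1))) :=
      Continuous.integrable_of_hasCompactSupport
        (hf.mul (Complex.continuous_conj.comp (hf.comp (continuous_add_const _)))) hfc.mul_right
    exact hi.2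
  · intro γ hγ
    contrapose! hγ
    rw [Set.Finite.mem_toFinset]
    obtain ⟨h1, h2⟩ := mul_ne_zero_iff.1 hγ
    constructor
    · have : ∃ y, f y * (starRingEnd ℂ) (f (y + γ.1.1)) ≠ 0 := by
        by_contra! h
        simp [h] at h2
      obtain ⟨y, hy⟩ := this
      obtain ⟨hy1, hy2⟩ := mul_ne_zero_iff.1 hy
      have e1 := hS (subset_tsupport f hy1)
      have e2 := hS (subset_tsupport f ((map_ne_zero _).1 hy2))
      rw [mem_closedBall_zero_iff] at e1 e2 ⊢
      simpa using (norm_sub_le (y + γ.1.1) y).trans (add_le_add e2 e1)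
    · have : (W ∩ (fun h => h + γ.1.2) ⁻¹' W).Nonempty := by
        by_contra! h
        simp [pairDensity, h] at h1
      obtain ⟨y, hy1, hy2⟩ := this
      have e1 := hR hy1
      have e2 := hR hy2
      rw [mem_closedBall_zero_iff] at e1 e2 ⊢
      simpa using (norm_sub_le (y + γ.1.2) y).trans (add_le_add e2 e1)

theorem integrable_secondMoment_cpProcess (hinj : Set.InjOn Prod.fst
      (Γ : Set (EuclideanSpace ℝ (Fin d₁) × EuclideanSpace ℝ (Fin d₂))))
    (hW : MeasurableSet W) (hWb : Bornology.IsBounded W)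
    {f : EuclideanSpace ℝ (Fin d₁) → ℂ} (hf : Continuous f) (hfc : HasCompactSupport f) :
    Integrable (fun z => f z.1 * (starRingEnd ℂ) (f z.2))
      (secondMoment (cpProb Γ) (cpProcess Γ W)) := by
  have hm : Measurable fun z : EuclideanSpace ℝ (Fin d₁) × EuclideanSpace ℝ (Fin d₁) =>
      f z.1 * (starRingEnd ℂ) (f z.2) := by
    have := hf.measurable
    exact (this.comp measurable_fst).mul
      (Complex.continuous_conj.measurable.comp (this.comp measurable_snd))
  refine ⟨hm.aestronglyMeasurable, ?_⟩
  rw [HasFiniteIntegral, lintegral_secondMoment_cpProcess hinj hW hm.enorm]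
  exact tsum_pairDensity_mul_lt_top hWb hf hfc

theorem integral_cpProcess_mk (hinj : Set.InjOn Prod.fst
      (Γ : Set (EuclideanSpace ℝ (Fin d₁) × EuclideanSpace ℝ (Fin d₂))))
    (x : EuclideanSpace ℝ (Fin d₁) × EuclideanSpace ℝ (Fin d₂))
    (f : EuclideanSpace ℝ (Fin d₁) → ℂ) :
    ∫ y, f y ∂(cpProcess Γ W (CPTorus.mk Γ x)) =
      ∑' γ : Γ, f (x.1 + γ.1.1) * W.indicator (fun _ => 1) (x.2 + γ.1.2) := by
  rw [cpProcess_mk hinj, integral_sum_dirac]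
  · refine tsum_congr fun γ => ?_
    by_cases h : x.2 + γ.1.2 ∈ W <;> simp [windowIndicator, h]
  · intro γ
    by_cases h : x.2 + γ.1.2 ∈ W <;> simp [windowIndicator, h]

theorem measurable_integral_cpProcess (hinj : Set.InjOn Prod.fst
      (Γ : Set (EuclideanSpace ℝ (Fin d₁) × EuclideanSpace ℝ (Fin d₂))))
    (hW : MeasurableSet W) {f : EuclideanSpace ℝ (Fin d₁) → ℂ} (hf : Continuous f) :
    Measurable fun ω => ∫ y, f y ∂(cpProcess Γ W ω) := by
  have := StronglyMeasurable.integral_kernel (κ := ⟨cpProcess Γ W, measurable_cpProcess hinj hW⟩)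
    hf.stronglyMeasurable
  exact this.measurable

/-- Both sides expand to the sum over `γ` of the pair density times `∫ f(y) conj (f(y + γ₁)) dy`,
since this integral is the value of `f ∗ f*` at `-γ₁`. -/
theorem integral_selfConvolution_autocorrelation (hinj : Set.InjOn Prod.fst
      (Γ : Set (EuclideanSpace ℝ (Fin d₁) × EuclideanSpace ℝ (Fin d₂))))
    (hW : MeasurableSet W) (hWb : Bornology.IsBounded W)
    {f : EuclideanSpace ℝ (Fin d₁) → ℂ} (hf : Continuous f) (hfc : HasCompactSupport f) :
    ∫ y, selfConvolution f y ∂autocorrelation (cpProb Γ) (cpProcess Γ W) =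
      ∫ z, f z.1 * (starRingEnd ℂ) (f z.2) ∂secondMoment (cpProb Γ) (cpProcess Γ W) := by
  have hi := integrable_secondMoment_cpProcess hinj hW hWb hf hfc
  have hm : Continuous fun z : EuclideanSpace ℝ (Fin d₁) × EuclideanSpace ℝ (Fin d₁) =>
      f z.1 * (starRingEnd ℂ) (f z.2) :=
    (hf.comp continuous_fst).mul (Complex.continuous_conj.comp (hf.comp continuous_snd))
  rw [secondMoment_cpProcess hinj hW] at hi ⊢
  rw [integral_sum_measure hi, autocorrelation_cpProcess hinj hW,
    integral_sum_dirac (pairDensity_ne_top hWb)]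
  refine tsum_congr fun γ => ?_
  rw [integral_smul_measure, integral_map (by fun_prop) hm.aestronglyMeasurable]
  congr 1
  rw [selfConvolution, convolution_def]
  simp

/-- The linear statistic of `f` is square integrable, with second moment `η⁺(f ∗ f*)`. -/
theorem memLp_and_integral_norm_sq_linear_statistic (hinj : Set.InjOn Prod.fst
      (Γ : Set (EuclideanSpace ℝ (Fin d₁) × EuclideanSpace ℝ (Fin d₂))))
    (hW : MeasurableSet W) (hWb : Bornology.IsBounded W)
    {f : EuclideanSpace ℝ (Fin d₁) → ℂ} (hf : Continuous f) (hfc : HasCompactSupport f) :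
    MemLp (fun ω => ∫ y, f y ∂(cpProcess Γ W ω)) 2 (cpProb Γ) ∧
    ((∫ ω, ‖∫ y, f y ∂(cpProcess Γ W ω)‖ ^ 2 ∂cpProb Γ : ℝ) : ℂ) =
      ∫ y, selfConvolution f y ∂autocorrelation (cpProb Γ) (cpProcess Γ W) := by
  have := sFinite_cpProcess (W := W) hinj
  obtain ⟨h1, h2⟩ := integrable_and_integral_bind (measurable_cpProcess_prod hinj hW)
    (integrable_secondMoment_cpProcess hinj hW hWb hf hfc)
  -- For fixed `ω`, Fubini factors the double integral into the linear statistic times its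
  -- conjugate.
  have key : ∀ ω, ∫ z, f z.1 * (starRingEnd ℂ) (f z.2)
      ∂(cpProcess Γ W ω).prod (cpProcess Γ W ω) =
      ((‖∫ y, f y ∂(cpProcess Γ W ω)‖ ^ 2 : ℝ) : ℂ) := fun ω => by
    rw [integral_prod_mul f (fun y => (starRingEnd ℂ) (f y)), integral_conj, Complex.mul_conj,
      Complex.normSq_eq_norm_sq]
  simp_rw [key] at h1 h2
  constructor
  · rw [memLp_two_iff_integrable_sq_norm
      (measurable_integral_cpProcess hinj hW hf).aestronglyMeasurable]
    exact h1.re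
  · rw [integral_selfConvolution_autocorrelation hinj hW hWb hf hfc]
    exact (integral_complex_ofReal).symm.trans h2.symm

/-- Unfolding the integral of a linear statistic against a periodic function. -/
theorem integral_cpDomain_mul_linear_statistic (hinj : Set.InjOn Prod.fst
      (Γ : Set (EuclideanSpace ℝ (Fin d₁) × EuclideanSpace ℝ (Fin d₂))))
    (hW : MeasurableSet W) (hWb : Bornology.IsBounded W)
    {f : EuclideanSpace ℝ (Fin d₁) → ℂ} (hf : Continuous f) (hfc : HasCompactSupport f)
    {χ : EuclideanSpace ℝ (Fin d₁) × EuclideanSpace ℝ (Fin d₂) → ℂ} (hχ : Continuous χ)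
    (hχ1 : ∀ x, ‖χ x‖ ≤ 1) (hχΓ : ∀ x, ∀ γ ∈ Γ, χ (x + γ) = χ x) :
    ∫ x in cpDomain Γ, χ x * ∫ y, f y ∂(cpProcess Γ W (CPTorus.mk Γ x)) =
      ∫ x, χ x * (f x.1 * W.indicator (fun _ => 1) x.2) := by
  have := isAddHaar_volume_prod (d₁ := d₁) (d₂ := d₂)
  have : Countable Γ.toAddSubgroup := inferInstanceAs (Countable Γ)
  have hWi : Integrable (W.indicator fun _ => (1 : ℂ)) :=
    (integrable_indicator_iff hW).2 (integrableOn_const hWb.measure_lt_top.ne)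
  have hΨ : Integrable (fun x : EuclideanSpace ℝ (Fin d₁) × EuclideanSpace ℝ (Fin d₂) =>
      χ x * (f x.1 * W.indicator (fun _ => 1) x.2)) :=
    ((hf.integrable_of_hasCompactSupport hfc).mul_prod hWi).bdd_mul (c := 1)
      hχ.aestronglyMeasurable (ae_of_all _ hχ1)
  have hm : ∀ γ : Γ, AEStronglyMeasurable (fun x => χ (x + γ.1) *
      (f (x + γ.1).1 * W.indicator (fun _ => 1) (x + γ.1).2)) (volume.restrict (cpDomain Γ)) :=
    fun γ => (hΨ.comp_add_right γ.1).aestronglyMeasurable.restrict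
  rw [(isAddFundamentalDomain_cpDomain (Γ := Γ)).integral_eq_tsum'' _ hΨ]
  have hsum := (isAddFundamentalDomain_cpDomain (Γ := Γ)).lintegral_eq_tsum''
    (fun x => ‖χ x * (f x.1 * W.indicator (fun _ => 1) x.2)‖ₑ)
  have hfin := hΨ.2
  rw [HasFiniteIntegral, hsum] at hfin
  have e : ∀ (γ : Γ.toAddSubgroup) (x : EuclideanSpace ℝ (Fin d₁) × EuclideanSpace ℝ (Fin d₂)),
      γ +ᵥ x = x + γ.1 := fun γ x => add_comm _ _
  simp_rw [e] at hfin ⊢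
  refine Eq.trans ?_ (integral_tsum hm hfin.ne)
  refine integral_congr_ae (ae_of_all _ fun x => ?_)
  -- Periodicity of `χ` lets it enter each term of the lattice sum.
  simp_rw [integral_cpProcess_mk hinj, ← tsum_mul_left]
  exact tsum_congr fun γ => by rw [hχΓ x γ.1 γ.2]; rfl

/-- The character of frequency `-ξ`. -/
def negCharacter (ξ x : EuclideanSpace ℝ (Fin d₁) × EuclideanSpace ℝ (Fin d₂)) : ℂ :=
  Real.fourierChar (-(inner ℝ x.1 ξ.1 + inner ℝ x.2 ξ.2))

theorem integral_negCharacter_mul (ξ : EuclideanSpace ℝ (Fin d₁) × EuclideanSpace ℝ (Fin d₂))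
    (f : EuclideanSpace ℝ (Fin d₁) → ℂ) (g : EuclideanSpace ℝ (Fin d₂) → ℂ) :
    ∫ x, negCharacter ξ x * (f x.1 * g x.2) = 𝓕 f ξ.1 * 𝓕 g ξ.2 := by
  rw [Real.fourier_eq, Real.fourier_eq, ← integral_prod_mul, Measure.volume_eq_prod]
  refine integral_congr_ae (ae_of_all _ fun x => ?_)
  simp only [negCharacter, neg_add, AddChar.map_add_eq_mul, Circle.coe_mul, Circle.smul_def,
    smul_eq_mul]
  ring

theorem integral_cpDomain_negCharacter (hinj : Set.InjOn Prod.fst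
      (Γ : Set (EuclideanSpace ℝ (Fin d₁) × EuclideanSpace ℝ (Fin d₂))))
    (hW : MeasurableSet W) (hWb : Bornology.IsBounded W)
    {f : EuclideanSpace ℝ (Fin d₁) → ℂ} (hf : Continuous f) (hfc : HasCompactSupport f)
    {ξ : EuclideanSpace ℝ (Fin d₁) × EuclideanSpace ℝ (Fin d₂)} (hξ : ξ ∈ dualLattice Γ) :
    ∫ x in cpDomain Γ, negCharacter ξ x * ∫ y, f y ∂(cpProcess Γ W (CPTorus.mk Γ x)) =
      𝓕 f ξ.1 * 𝓕 (W.indicator fun _ => (1 : ℂ)) ξ.2 := by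
  rw [integral_cpDomain_mul_linear_statistic hinj hW hWb hf hfc, integral_negCharacter_mul]
  · unfold negCharacter
    exact continuous_subtype_val.comp (Real.continuous_fourierChar.comp (by fun_prop))
  · intro x
    exact (Circle.norm_coe _).le
  · intro x γ hγ
    have h := hξ γ hγ
    simp only [negCharacter, Prod.fst_add, Prod.snd_add, inner_add_left]
    rw [add_add_add_comm, neg_add, AddChar.map_add_eq_mul,
      AddChar.map_neg_eq_inv _ (inner ℝ γ.1 _ + _), h, inv_one, mul_one]

end Lattices

/-! ### Parseval's identity on cubes and fundamental parallelepipeds -/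

section Parseval

variable {ι : Type*} [Fintype ι]

/-- The half-open unit cube. -/
def unitCubeIoc (ι : Type*) : Set (ι → ℝ) := {x | ∀ i, x i ∈ Ioc (0 : ℝ) 1}

/-- The exponential monomial `x ↦ exp(-2πi ∑ n_i x_i)`. -/
def negExponential (n : ι → ℤ) (x : ι → ℝ) : ℂ :=
  Complex.exp (-(2 * Real.pi * Complex.I * ((∑ i, n i * x i : ℝ) : ℂ)))

section

local instance : MeasureSpace UnitAddCircle := ⟨AddCircle.haarAddCircle⟩

local instance : IsProbabilityMeasure (volume : Measure UnitAddCircle) :=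
  inferInstanceAs (IsProbabilityMeasure AddCircle.haarAddCircle)

theorem measurePreserving_unitAddTorus_representative :
    MeasurePreserving (fun s : UnitAddTorus ι => (UnitAddTorus.measurableEquivPiIoc 0 s).1)
      volume (volume.restrict (unitCubeIoc ι)) := by
  have h := UnitAddTorus.measurePreserving_equivPiIoc (d := ι) 0
  have hs : MeasurableSet {x : ι → ℝ | ∀ i, x i ∈ Ioc ((0 : ι → ℝ) i) ((0 : ι → ℝ) i + 1)} :=
    MeasurableSet.univ_pi' fun i => measurableSet_Ioc
  have := (measurePreserving_subtype_coe (μa := volume) hs).comp h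
  convert! this using 2
  simp [unitCubeIoc]

/-- **Parseval's identity** on the unit cube. -/
theorem hasSum_sq_norm_integral_unitCubeIoc {G : (ι → ℝ) → ℂ}
    (hG : MemLp G 2 (volume.restrict (unitCubeIoc ι))) :
    HasSum (fun n : ι → ℤ => ‖∫ x in unitCubeIoc ι, negExponential n x * G x‖ ^ 2)
      (∫ x in unitCubeIoc ι, ‖G x‖ ^ 2) := by
  have hQ : unitCubeIoc ι = {x : ι → ℝ | ∀ i, x i ∈ Ioc ((0 : ι → ℝ) i) ((0 : ι → ℝ) i + 1)} := by
    simp [unitCubeIoc]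
  have hs : MeasurableSet {x : ι → ℝ | ∀ i, x i ∈ Ioc ((0 : ι → ℝ) i) ((0 : ι → ℝ) i + 1)} :=
    MeasurableSet.univ_pi' fun i => measurableSet_Ioc
  set G' : UnitAddTorus ι → ℂ := fun s => G (UnitAddTorus.measurableEquivPiIoc 0 s).1
  have hG' : MemLp G' 2 volume :=
    hG.comp_measurePreserving measurePreserving_unitAddTorus_representative
  have hrep : ∀ x ∈ {x : ι → ℝ | ∀ i, x i ∈ Ioc ((0 : ι → ℝ) i) ((0 : ι → ℝ) i + 1)},
      G' (fun i => x i) = G x := fun x hx => by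
    have := (UnitAddTorus.measurableEquivPiIoc (0 : ι → ℝ)).apply_symm_apply ⟨x, hx⟩
    rw [UnitAddTorus.coe_symm_measurableEquivPiIoc_apply] at this
    simp only [G']
    rw [this]
  have key := UnitAddTorus.hasSum_sq_mFourierCoeff (hG'.toLp G')
  have e1 : ∫ t, ‖hG'.toLp G' t‖ ^ 2 = ∫ x in unitCubeIoc ι, ‖G x‖ ^ 2 := by
    rw [integral_congr_ae (g := fun t => ‖G' t‖ ^ 2)
      (by filter_upwards [hG'.coeFn_toLp] with t ht; rw [ht]),
      UnitAddTorus.integral_preimage (fun t => ‖G' t‖ ^ 2) 0, hQ]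
    exact setIntegral_congr_fun hs fun x hx => by simp only [hrep x hx]
  have e2 : ∀ n : ι → ℤ, UnitAddTorus.mFourierCoeff (hG'.toLp G') n =
      ∫ x in unitCubeIoc ι, negExponential n x * G x := fun n => by
    have : UnitAddTorus.mFourierCoeff (hG'.toLp G') n = UnitAddTorus.mFourierCoeff G' n :=
      integral_congr_ae (by filter_upwards [hG'.coeFn_toLp] with t ht; rw [ht])
    rw [this, UnitAddTorus.mFourierCoeff_eq_integral _ _ 0, hQ]
    refine setIntegral_congr_fun hs fun x hx => ?_
    simp only [hrep x hx, smul_eq_mul]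
    congr 1
    simp only [UnitAddTorus.mFourier, ContinuousMap.coe_mk, fourier_coe_apply, negExponential]
    rw [← Complex.exp_sum]
    congr 1
    push_cast
    rw [Finset.mul_sum, ← Finset.sum_neg_distrib]
    refine Finset.sum_congr rfl fun i _ => ?_
    simp
    ring
  simp_rw [e2] at key
  rwa [e1] at key

end

variable {E : Type*} [NormedAddCommGroup E] [NormedSpace ℝ E] [MeasurableSpace E] [BorelSpace E]
  [FiniteDimensional ℝ E]

/-- Coordinates with respect to `b` transport Lebesgue measure to a Haar measure, hence to a
multiple of `μ`. Normalizing on the fundamental domain makes the choice of `μ` irrelevant. -/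
theorem measurePreserving_unitCubeIoc (μ : Measure E) [μ.IsAddHaarMeasure]
    (b : Module.Basis ι ℝ E) :
    MeasurePreserving b.equivFunL.symm (volume.restrict (unitCubeIoc ι))
      ((μ (ZSpan.fundamentalDomain b))⁻¹ • μ.restrict (ZSpan.fundamentalDomain b)) := by
  have hpre : b.equivFunL.symm ⁻¹' (ZSpan.fundamentalDomain b) =
      Set.pi univ fun _ => Ico (0 : ℝ) 1 := by
    ext x
    simp only [mem_preimage, ZSpan.mem_fundamentalDomain, Set.mem_pi, mem_univ, true_imp_iff]
    refine forall_congr' fun i => ?_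
    have : b.repr (b.equivFunL.symm x) i = x i := by
      have := congrFun (b.equivFun.apply_symm_apply x) i
      exact this
    rw [this]
  -- The torus representatives lie in `(0, 1]` while the fundamental domain uses `[0, 1)`; the two
  -- cubes differ by a null set.
  have hcube : volume.restrict (unitCubeIoc ι) =
      volume.restrict (Set.pi univ fun _ : ι => Ico (0 : ℝ) 1) := by
    refine Measure.restrict_congr_set ?_
    have h1 : unitCubeIoc ι = Set.pi univ fun _ => Ioc (0 : ℝ) 1 := by
      ext; simp [unitCubeIoc]
    rw [h1]
    exact Measure.univ_pi_Ioc_ae_eq_Icc.trans Measure.univ_pi_Ico_ae_eq_Icc.symm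
  have hm : Measurable (b.equivFunL.symm : (ι → ℝ) → E) := b.equivFunL.symm.continuous.measurable
  have hD : MeasurableSet (ZSpan.fundamentalDomain b) := ZSpan.fundamentalDomain_measurableSet b
  refine ⟨hm, ?_⟩
  have hHaar : (Measure.map b.equivFunL.symm (volume : Measure (ι → ℝ))).IsAddHaarMeasure :=
    inferInstance
  have hsm := Measure.isAddLeftInvariant_eq_smul (Measure.map b.equivFunL.symm volume) μ
  set c := (Measure.map b.equivFunL.symm (volume : Measure (ι → ℝ))).addHaarScalarFactor μ
  -- The scalar is determined by the fundamental domain, whose preimage is a cube of volume one.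
  have h1 : (c : ℝ≥0∞) * μ (ZSpan.fundamentalDomain b) = 1 := by
    have : Measure.map b.equivFunL.symm volume (ZSpan.fundamentalDomain b) =
        c * μ (ZSpan.fundamentalDomain b) := by rw [hsm]; rfl
    rw [← this, Measure.map_apply hm hD, hpre, volume_pi_pi]
    simp
  rw [hcube, ← hpre, ← Measure.restrict_map hm hD, hsm, Measure.restrict_smul]
  rw [← ENNReal.eq_inv_of_mul_eq_one_left h1]
  rfl

/-- **Parseval's identity** on the fundamental parallelepiped of a basis. -/
theorem hasSum_sq_norm_integral_fundamentalDomain (μ : Measure E) [μ.IsAddHaarMeasure]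
    (b : Module.Basis ι ℝ E) {G : E → ℂ}
    (hG : MemLp G 2 ((μ (ZSpan.fundamentalDomain b))⁻¹ • μ.restrict (ZSpan.fundamentalDomain b))) :
    HasSum (fun n : ι → ℤ => ‖(μ (ZSpan.fundamentalDomain b)).toReal⁻¹ •
        ∫ x in ZSpan.fundamentalDomain b, negExponential n (b.equivFun x) * G x ∂μ‖ ^ 2)
      ((μ (ZSpan.fundamentalDomain b)).toReal⁻¹ •
        ∫ x in ZSpan.fundamentalDomain b, ‖G x‖ ^ 2 ∂μ) := by
  have hmp := measurePreserving_unitCubeIoc μ b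
  have he : MeasurableEmbedding (b.equivFunL.symm : (ι → ℝ) → E) :=
    b.equivFunL.symm.toHomeomorph.measurableEmbedding
  have key := hasSum_sq_norm_integral_unitCubeIoc (hG.comp_measurePreserving hmp)
  have e1 := hmp.integral_comp he (fun x => ‖G x‖ ^ 2)
  have e2 := fun n : ι → ℤ => hmp.integral_comp he (fun x => negExponential n (b.equivFun x) * G x)
  have e3 : ∀ x, b.equivFun (b.equivFunL.symm x) = x := fun x => b.equivFun.apply_symm_apply x
  simp only [e3] at e2
  simp only [Function.comp_def, e1, e2] at key
  simpa only [integral_smul_measure, ENNReal.toReal_inv] using key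

end Parseval

/-! ### Uniqueness of the Fourier transform -/

section Uniqueness

variable {d : ℕ}

/-- There are test functions whose Fourier transform is bounded below on a given ball. -/
theorem exists_half_le_norm_fourier (R : ℝ) (hR : 0 < R) :
    ∃ g : EuclideanSpace ℝ (Fin d) → ℂ, Continuous g ∧ HasCompactSupport g ∧
      ∀ ξ, ‖ξ‖ ≤ R → 1 / 2 ≤ ‖𝓕 g ξ‖ := by
  have hπ := Real.pi_pos
  -- A normalized bump supported in radius `r` satisfies `|ĝ(ξ) - 1| ≤ 2π r R = 1/2` for `‖ξ‖ ≤ R`.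
  set r : ℝ := 1 / (4 * Real.pi * R)
  have hr : 0 < r := by positivity
  let φ : ContDiffBump (0 : EuclideanSpace ℝ (Fin d)) := ⟨r / 2, r, by positivity, by linarith⟩
  have hφc : Continuous (φ.normed volume) := φ.continuous_normed
  have hφs : HasCompactSupport (φ.normed volume) := φ.hasCompactSupport_normed
  have hφi : Integrable (φ.normed volume) volume := φ.integrable_normed
  refine ⟨fun x => (φ.normed volume x : ℂ), Complex.continuous_ofReal.comp hφc,
    hφs.comp_left Complex.ofReal_zero, fun ξ hξ => ?_⟩
  have hone : ∫ x, ((φ.normed volume x : ℝ) : ℂ) = 1 := by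
    rw [integral_complex_ofReal, φ.integral_normed, Complex.ofReal_one]
  have hint : Integrable fun x => (φ.normed volume x : ℂ) := hφi.ofReal
  have hint' : Integrable fun x : EuclideanSpace ℝ (Fin d) =>
      Real.fourierChar (-inner ℝ x ξ) • (φ.normed volume x : ℂ) := by
    have := (Real.fourierIntegral_convergent_iff ξ).2 hint
    exact this
  have hdiff : ‖𝓕 (fun x => (φ.normed volume x : ℂ)) ξ - 1‖ ≤ 1 / 2 := by
    rw [← hone, Real.fourier_eq, ← integral_sub hint' hint]
    calc ‖∫ x, (Real.fourierChar (-inner ℝ x ξ) • (φ.normed volume x : ℂ) -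
          (φ.normed volume x : ℂ))‖
        ≤ ∫ x, 1 / 2 * φ.normed volume x := by
          refine norm_integral_le_of_norm_le (hφi.const_mul _) (ae_of_all _ fun x => ?_)
          by_cases hx : φ.normed volume x = 0
          · simp [hx]
          have hxr : ‖x‖ < r := by
            have : x ∈ Function.support (φ.normed volume) := hx
            rw [φ.support_normed_eq] at this
            simpa using this
          rw [Circle.smul_def, smul_eq_mul, ← sub_one_mul, norm_mul, Complex.norm_real,
            Real.norm_of_nonneg (φ.nonneg_normed x)]
          refine mul_le_mul_of_nonneg_right ?_ (φ.nonneg_normed x)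
          rw [Real.fourierChar_apply, mul_comm _ Complex.I]
          refine Real.norm_exp_I_mul_ofReal_sub_one_le.trans ?_
          rw [Real.norm_eq_abs, abs_mul, abs_neg, abs_of_pos (by positivity)]
          calc 2 * Real.pi * |inner ℝ x ξ| ≤ 2 * Real.pi * (r * R) := by
                refine mul_le_mul_of_nonneg_left ?_ (by positivity)
                exact (abs_real_inner_le_norm x ξ).trans
                  (mul_le_mul hxr.le hξ (norm_nonneg _) hr.le)
            _ = 1 / 2 := by simp only [r]; field_simp; norm_num
      _ = 1 / 2 := by rw [integral_const_mul, φ.integral_normed, mul_one]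
  have := norm_sub_norm_le (1 : ℂ) (1 - 𝓕 (fun x => (φ.normed volume x : ℂ)) ξ)
  rw [sub_sub_cancel, norm_one, norm_sub_rev] at this
  linarith

theorem continuous_fourier_of_hasCompactSupport {f : EuclideanSpace ℝ (Fin d) → ℂ}
    (hf : Continuous f) (hfc : HasCompactSupport f) : Continuous (𝓕 f) :=
  VectorFourier.fourierIntegral_continuous Real.continuous_fourierChar continuous_inner
    (hf.integrable_of_hasCompactSupport hfc)

/-- Polarization: `|1 + cu|² = 2 + 2 Re(cu)` for unimodular `c` and `u`. With `z = ĝ(ξ)` and `u` a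
character, it expresses the character times `|ĝ|²` through squared transforms of the test functions
`g + c g(· + a)`. -/
theorem norm_sq_one_add_mul (c u z : ℂ) (hc : ‖c‖ = 1) (hu : ‖u‖ = 1) :
    (c * u).re * ‖z‖ ^ 2 = (‖z + c * (u * z)‖ ^ 2 - 2 * ‖z‖ ^ 2) / 2 := by
  have h1 : z + c * (u * z) = (1 + c * u) * z := by ring
  have h2 : ‖1 + c * u‖ ^ 2 = 2 + 2 * (c * u).re := by
    have h3 : Complex.normSq (c * u) = 1 := by
      rw [Complex.normSq_eq_norm_sq, norm_mul, hc, hu]; norm_num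
    rw [← Complex.normSq_eq_norm_sq, Complex.normSq_add, h3]
    simp
    ring
  rw [h1, norm_mul, mul_pow, h2]
  ring

theorem fourier_add_translate {g : EuclideanSpace ℝ (Fin d) → ℂ}
    (hg : Continuous g) (hgc : HasCompactSupport g) (c : ℂ) (a ξ : EuclideanSpace ℝ (Fin d)) :
    𝓕 (fun x => g x + c * g (x + a)) ξ =
      𝓕 g ξ + c * (Real.fourierChar (inner ℝ a ξ) * 𝓕 g ξ) := by
  have hgi := hg.integrable_of_hasCompactSupport hgc (μ := volume)
  have h1 : Integrable fun x : EuclideanSpace ℝ (Fin d) =>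
      Real.fourierChar (-inner ℝ x ξ) • g x := (Real.fourierIntegral_convergent_iff ξ).2 hgi
  have h2 : Integrable fun x : EuclideanSpace ℝ (Fin d) =>
      Real.fourierChar (-inner ℝ x ξ) • g (x + a) :=
    (Real.fourierIntegral_convergent_iff ξ).2 (hgi.comp_add_right a)
  have h3 := congrFun (VectorFourier.fourierIntegral_comp_add_right Real.fourierChar
    (volume : Measure (EuclideanSpace ℝ (Fin d))) (innerₗ _) g a) ξ
  have h4 : ∫ x : EuclideanSpace ℝ (Fin d), Real.fourierChar (-inner ℝ x ξ) • g (x + a) =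
      Real.fourierChar (inner ℝ a ξ) * 𝓕 g ξ := h3
  rw [← h4, Real.fourier_eq, Real.fourier_eq, ← integral_const_mul,
    ← integral_add h1 (h2.const_mul c)]
  refine integral_congr_ae (ae_of_all _ fun x => ?_)
  simp only [Circle.smul_def, smul_eq_mul]
  ring

/-- The Fourier transform of a functional is unique. -/
theorem IsFourierTransformOf.unique {μ ν : Measure (EuclideanSpace ℝ (Fin d))}
    {η : (EuclideanSpace ℝ (Fin d) → ℂ) → ℂ} (hμ : IsFourierTransformOf μ η)
    (hν : IsFourierTransformOf ν η) : μ = ν := by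
  have heq : ∀ f : EuclideanSpace ℝ (Fin d) → ℂ, Continuous f → HasCompactSupport f →
      ∫ ξ, ‖𝓕 f ξ‖ ^ 2 ∂μ = ∫ ξ, ‖𝓕 f ξ‖ ^ 2 ∂ν := fun f hf hfc =>
    Complex.ofReal_injective ((hμ.integral_eq f hf hfc).trans (hν.integral_eq f hf hfc).symm)
  -- The measures themselves may be infinite, but `|ĝ|² μ` is finite, so characteristic functions
  -- apply to it.
  have hdens : ∀ g : EuclideanSpace ℝ (Fin d) → ℂ, Continuous g → HasCompactSupport g →
      μ.withDensity (fun ξ => ENNReal.ofReal (‖𝓕 g ξ‖ ^ 2)) =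
        ν.withDensity (fun ξ => ENNReal.ofReal (‖𝓕 g ξ‖ ^ 2)) := by
    intro g hg hgc
    have hF := continuous_fourier_of_hasCompactSupport hg hgc
    have hcm : Measurable fun ξ => ENNReal.ofReal (‖𝓕 g ξ‖ ^ 2) :=
      (hF.norm.pow 2).measurable.ennreal_ofReal
    have hfin : ∀ {ρ : Measure (EuclideanSpace ℝ (Fin d))}, IsFourierTransformOf ρ η →
        IsFiniteMeasure (ρ.withDensity fun ξ => ENNReal.ofReal (‖𝓕 g ξ‖ ^ 2)) := fun hρ =>
      isFiniteMeasure_withDensity_ofReal (hρ.integrable g hg hgc).2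
    have := hfin hμ
    have := hfin hν
    have hre : ∀ (c : ℂ), ‖c‖ = 1 → ∀ a : EuclideanSpace ℝ (Fin d),
        ∀ {ρ : Measure (EuclideanSpace ℝ (Fin d))}, IsFourierTransformOf ρ η →
        ∫ ξ, (c * Real.fourierChar (inner ℝ a ξ)).re * ‖𝓕 g ξ‖ ^ 2 ∂ρ =
          ((∫ ξ, ‖𝓕 (fun x => g x + c * g (x + a)) ξ‖ ^ 2 ∂ρ) -
            2 * ∫ ξ, ‖𝓕 g ξ‖ ^ 2 ∂ρ) / 2 := by
      intro c hc a ρ hρ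
      have hh : Continuous fun x => g x + c * g (x + a) := by fun_prop
      have hhc : HasCompactSupport fun x => g x + c * g (x + a) :=
        hgc.add ((hgc.comp_homeomorph (Homeomorph.addRight a)).mul_left)
      rw [← integral_const_mul, ← integral_sub (hρ.integrable _ hh hhc)
        ((hρ.integrable g hg hgc).const_mul 2), ← integral_div]
      refine integral_congr_ae (ae_of_all _ fun ξ => ?_)
      simp only [fourier_add_translate hg hgc]
      exact norm_sq_one_add_mul c _ _ hc (Circle.norm_coe _)
    have hint : ∀ (a : EuclideanSpace ℝ (Fin d)) {ρ : Measure (EuclideanSpace ℝ (Fin d))},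
        IsFourierTransformOf ρ η → Integrable (fun ξ => (Real.fourierChar (inner ℝ a ξ) : ℂ) *
          ((‖𝓕 g ξ‖ ^ 2 : ℝ) : ℂ)) ρ := by
      intro a ρ hρ
      refine (hρ.integrable g hg hgc).ofReal.bdd_mul (c := 1) ?_
        (ae_of_all _ fun ξ => (Circle.norm_coe _).le)
      exact (continuous_subtype_val.comp
        (Real.continuous_fourierChar.comp (by fun_prop))).aestronglyMeasurable
    have hchar : ∀ a : EuclideanSpace ℝ (Fin d),
        ∫ ξ, (Real.fourierChar (inner ℝ a ξ) : ℂ) * ((‖𝓕 g ξ‖ ^ 2 : ℝ) : ℂ) ∂μ =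
          ∫ ξ, (Real.fourierChar (inner ℝ a ξ) : ℂ) * ((‖𝓕 g ξ‖ ^ 2 : ℝ) : ℂ) ∂ν := by
      intro a
      -- The choices `c = 1` and `c = -i` give the real and the imaginary part of the integral of
      -- the character.
      have key : ∀ c : ℂ, ‖c‖ = 1 →
          ∫ ξ, (c * Real.fourierChar (inner ℝ a ξ)).re * ‖𝓕 g ξ‖ ^ 2 ∂μ =
            ∫ ξ, (c * Real.fourierChar (inner ℝ a ξ)).re * ‖𝓕 g ξ‖ ^ 2 ∂ν := by
        intro c hc
        rw [hre c hc a hμ, hre c hc a hν, heq g hg hgc,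
          heq (fun x => g x + c * g (x + a)) (by fun_prop)
          (hgc.add ((hgc.comp_homeomorph (Homeomorph.addRight a)).mul_left))]
      apply Complex.ext
      · have h1 := key 1 (by simp)
        have h2 := integral_re (hint a hμ)
        have h3 := integral_re (hint a hν)
        simp only [RCLike.re_to_complex, Complex.re_mul_ofReal] at h2 h3
        simp only [one_mul] at h1
        rw [← h2, ← h3, h1]
      · have h1 := key (-Complex.I) (by simp)
        have h2 := integral_im (hint a hμ)
        have h3 := integral_im (hint a hν)
        simp only [RCLike.im_to_complex, Complex.im_mul_ofReal] at h2 h3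
        simp only [neg_mul, Complex.neg_re, Complex.I_mul_re, neg_neg] at h1
        rw [← h2, ← h3, h1]
    -- Characteristic functions use `exp(i⟨ξ, t⟩)`, whence the rescaled frequency `t / (2π)`.
    refine Measure.ext_of_charFun (funext fun t => ?_)
    have h1 : ∀ {ρ : Measure (EuclideanSpace ℝ (Fin d))},
        charFun (ρ.withDensity fun ξ => ENNReal.ofReal (‖𝓕 g ξ‖ ^ 2)) t =
          ∫ ξ, (Real.fourierChar (inner ℝ ((2 * Real.pi)⁻¹ • t) ξ) : ℂ) *
            ((‖𝓕 g ξ‖ ^ 2 : ℝ) : ℂ) ∂ρ := by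
      intro ρ
      rw [charFun_apply, integral_withDensity_eq_integral_toReal_smul hcm (by simp)]
      refine integral_congr_ae (ae_of_all _ fun ξ => ?_)
      simp only [ENNReal.toReal_ofReal (sq_nonneg _), Complex.real_smul, Real.fourierChar_apply,
        real_inner_smul_left]
      rw [mul_comm, mul_inv_cancel_left₀ (by positivity), real_inner_comm]
    rw [h1, h1, hchar]
  -- On each ball some `|ĝ|` is at least `1/2`, so the density `|ĝ|²` can be divided out again.
  refine Measure.ext_of_iUnion_eq_univ (s := fun n : ℕ => Metric.closedBall 0 (n + 1))
    ?_ fun n => ?_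
  · refine eq_univ_of_forall fun ξ => mem_iUnion.2 ?_
    obtain ⟨n, hn⟩ := exists_nat_ge ‖ξ‖
    exact ⟨n, by rw [mem_closedBall_zero_iff]; linarith⟩
  · obtain ⟨g, hg, hgc, hg2⟩ := exists_half_le_norm_fourier (d := d) (n + 1) (by positivity)
    have hF := continuous_fourier_of_hasCompactSupport hg hgc
    have hcm : Measurable fun ξ => ENNReal.ofReal (‖𝓕 g ξ‖ ^ 2) :=
      (hF.norm.pow 2).measurable.ennreal_ofReal
    have hB : MeasurableSet (Metric.closedBall (0 : EuclideanSpace ℝ (Fin d)) (n + 1)) :=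
      measurableSet_closedBall
    have hinv : ∀ ρ : Measure (EuclideanSpace ℝ (Fin d)),
        ρ.restrict (Metric.closedBall 0 (n + 1)) =
          ((ρ.withDensity fun ξ => ENNReal.ofReal (‖𝓕 g ξ‖ ^ 2)).restrict
            (Metric.closedBall 0 (n + 1))).withDensity
            (fun ξ => ENNReal.ofReal (‖𝓕 g ξ‖ ^ 2))⁻¹ := by
      intro ρ
      rw [restrict_withDensity hB]
      refine (withDensity_inv_same hcm ?_ (by simp)).symm
      filter_upwards [ae_restrict_mem hB] with ξ hξ
      have := hg2 ξ (by simpa using hξ)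
      rw [ne_eq, ENNReal.ofReal_eq_zero, not_le]
      positivity
    rw [hinv μ, hinv ν, hdens g hg hgc]

end Uniqueness

/-! ### Parametrization of dual lattice vectors -/

section DualBasis

variable {d₁ d₂ : ℕ} {ι : Type*} [Fintype ι]

/-- Linear functionals on a product of Euclidean spaces are given by pairs of vectors. -/
theorem exists_inner_add_inner_eq
    (ℓ : EuclideanSpace ℝ (Fin d₁) × EuclideanSpace ℝ (Fin d₂) →ₗ[ℝ] ℝ) :
    ∃ ξ : EuclideanSpace ℝ (Fin d₁) × EuclideanSpace ℝ (Fin d₂),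
      ∀ x, inner ℝ x.1 ξ.1 + inner ℝ x.2 ξ.2 = ℓ x := by
  refine ⟨((InnerProductSpace.toDual ℝ _).symm
      (LinearMap.toContinuousLinearMap (ℓ ∘ₗ LinearMap.inl ℝ _ _)),
    (InnerProductSpace.toDual ℝ _).symm
      (LinearMap.toContinuousLinearMap (ℓ ∘ₗ LinearMap.inr ℝ _ _))), fun x => ?_⟩
  rw [real_inner_comm, real_inner_comm _ x.2, InnerProductSpace.toDual_symm_apply,
    InnerProductSpace.toDual_symm_apply]
  simp [← map_add]

theorem eq_of_inner_add_inner_eq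
    {ξ ζ : EuclideanSpace ℝ (Fin d₁) × EuclideanSpace ℝ (Fin d₂)}
    (h : ∀ x : EuclideanSpace ℝ (Fin d₁) × EuclideanSpace ℝ (Fin d₂),
      inner ℝ x.1 ξ.1 + inner ℝ x.2 ξ.2 = inner ℝ x.1 ζ.1 + inner ℝ x.2 ζ.2) : ξ = ζ := by
  refine Prod.ext (ext_inner_left ℝ fun v => ?_) (ext_inner_left ℝ fun v => ?_)
  · simpa using h (v, 0)
  · simpa using h (0, v)

/-- The integral combinations of the dual basis of `b`. -/
def dualVector (b : Module.Basis ι ℝ (EuclideanSpace ℝ (Fin d₁) × EuclideanSpace ℝ (Fin d₂)))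
    (n : ι → ℤ) : EuclideanSpace ℝ (Fin d₁) × EuclideanSpace ℝ (Fin d₂) :=
  (exists_inner_add_inner_eq (∑ i, (n i : ℝ) • b.coord i)).choose

variable (b : Module.Basis ι ℝ (EuclideanSpace ℝ (Fin d₁) × EuclideanSpace ℝ (Fin d₂)))

theorem inner_dualVector (n : ι → ℤ)
    (x : EuclideanSpace ℝ (Fin d₁) × EuclideanSpace ℝ (Fin d₂)) :
    inner ℝ x.1 (dualVector b n).1 + inner ℝ x.2 (dualVector b n).2 =
      ∑ i, n i * b.equivFun x i := by
  have := (exists_inner_add_inner_eq (∑ i, (n i : ℝ) • b.coord i)).choose_spec x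
  rw [dualVector, this]
  simp

theorem dualVector_sub (n m : ι → ℤ) :
    dualVector b (n - m) = dualVector b n - dualVector b m := by
  refine eq_of_inner_add_inner_eq fun x => ?_
  rw [Prod.fst_sub, Prod.snd_sub, inner_sub_right, inner_sub_right, sub_add_sub_comm,
    inner_dualVector, inner_dualVector, inner_dualVector, ← Finset.sum_sub_distrib]
  exact Finset.sum_congr rfl fun i _ => by simp; ring

theorem dualVector_ne_zero {n : ι → ℤ} (hn : n ≠ 0) : dualVector b n ≠ 0 := by
  classical
  contrapose! hn
  ext i
  have := inner_dualVector b n (b i)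
  simpa [hn, Finsupp.single_apply] using this.symm

theorem dualVector_zero : dualVector b 0 = 0 := by
  have := dualVector_sub b 0 0
  simpa using this

theorem negCharacter_dualVector (n : ι → ℤ)
    (x : EuclideanSpace ℝ (Fin d₁) × EuclideanSpace ℝ (Fin d₂)) :
    negCharacter (dualVector b n) x = negExponential n (b.equivFun x) := by
  rw [negCharacter, inner_dualVector, negExponential, Real.fourierChar_apply]
  congr 1
  push_cast
  ring

/-- Lattice points have integer coordinates in a lattice basis, so their pairing with an integral
combination of the dual basis is an integer. -/
theorem dualVector_mem_dualLattice
    {Γ : Submodule ℤ (EuclideanSpace ℝ (Fin d₁) × EuclideanSpace ℝ (Fin d₂))}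
    [DiscreteTopology Γ] [IsZLattice ℝ Γ] (b : Module.Basis ι ℤ Γ) (n : ι → ℤ) :
    dualVector (b.ofZLatticeBasis ℝ) n ∈ dualLattice Γ := by
  intro γ hγ
  rw [inner_dualVector]
  have h : ∀ i, (b.ofZLatticeBasis ℝ).equivFun γ i = (b.repr ⟨γ, hγ⟩ i : ℤ) := fun i => by
    have := b.ofZLatticeBasis_repr_apply ℝ Γ ⟨γ, hγ⟩ i
    simpa using this
  have h2 : ∑ i, n i * (b.ofZLatticeBasis ℝ).equivFun γ i =
      ((∑ i, n i * b.repr ⟨γ, hγ⟩ i : ℤ) : ℝ) := by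
    simp [h]
  rw [h2]
  ext
  rw [Real.fourierChar_apply, Circle.coe_one]
  refine Complex.exp_eq_one_iff.2 ⟨∑ i, n i * b.repr ⟨γ, hγ⟩ i, ?_⟩
  push_cast
  ring

end DualBasis

/-! ### Power sums over separated sets -/

section Separated

variable {d : ℕ}

theorem summable_one_add_norm_rpow_neg {s : ℝ} (hs : d < s) :
    Summable fun n : Fin d → ℤ => (1 + ‖fun i => (n i : ℝ)‖) ^ (-s) := by
  let b := Pi.basisFun ℝ (Fin d)
  let L : Submodule ℤ (Fin d → ℝ) := Submodule.span ℤ (range b)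
  have hr : Module.finrank ℤ L = d := by
    rw [ZLattice.rank ℝ L, Module.finrank_fin_fun]
  have hmem : ∀ n : Fin d → ℤ, (fun i => (n i : ℝ)) ∈ L := fun n => by
    rw [Module.Basis.mem_span_iff_repr_mem ℤ]
    intro i
    exact ⟨n i, by simp [b]⟩
  have h1 := ZLattice.summable_norm_rpow L (-s) (by rw [hr]; linarith)
  have hinj : Function.Injective fun n : Fin d → ℤ => (⟨_, hmem n⟩ : L) := fun n m h => by
    ext i
    have : (n i : ℝ) = m i := congrFun (congrArg Subtype.val h) i
    exact_mod_cast this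
  have h2 := h1.comp_injective hinj
  -- The comparison with `‖n‖ ^ (-s)` fails at `n = 0`, where that power is `0` by convention.
  refine Summable.of_norm_bounded_eventually h2 ?_
  filter_upwards [(Set.finite_singleton (0 : Fin d → ℤ)).compl_mem_cofinite] with n hn
  have hpos : 0 < ‖fun i => (n i : ℝ)‖ := by
    rw [norm_pos_iff]
    contrapose! hn
    simp only [mem_compl_iff, mem_singleton_iff, not_not]
    ext i
    have : (n i : ℝ) = 0 := congrFun hn i
    exact_mod_cast this
  rw [Real.norm_of_nonneg (by positivity)]
  have hd : (0 : ℝ) ≤ d := d.cast_nonneg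
  exact Real.rpow_le_rpow_of_nonpos hpos (le_add_of_nonneg_left zero_le_one) (by linarith)

theorem norm_ofLp_le_norm (v : EuclideanSpace ℝ (Fin d)) : ‖WithLp.ofLp v‖ ≤ ‖v‖ :=
  (pi_norm_le_iff_of_nonneg (norm_nonneg _)).2 fun k => PiLp.norm_apply_le v k

theorem abs_floor_le (x : ℝ) : |(⌊x⌋ : ℝ)| ≤ |x| + 1 := by
  have h1 := Int.floor_le x
  have h2 := Int.lt_floor_add_one x
  rw [abs_le]
  constructor
  · linarith [neg_abs_le x]
  · linarith [le_abs_self x]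

/-- Sums of a power of the norm over separated sets. -/
theorem exists_tsum_separated_le {s : ℝ} (hs : d < s) :
    ∃ C : ℝ, 0 < C ∧ ∀ (ι : Type) (v : ι → EuclideanSpace ℝ (Fin d)) (r : ℝ), 0 < r →
      (∀ i, r ≤ ‖WithLp.ofLp (v i)‖) →
      (∀ i j, i ≠ j → r ≤ ‖WithLp.ofLp (v i - v j)‖) →
      ∑' i, ENNReal.ofReal ((1 + ‖v i‖) ^ (-s)) ≤ ENNReal.ofReal (C * r ^ (-s)) := by
  have hs0 : 0 < s := lt_of_le_of_lt d.cast_nonneg hs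
  have hsum := summable_one_add_norm_rpow_neg hs
  set T := ∑' n : Fin d → ℤ, (1 + ‖fun i => (n i : ℝ)‖) ^ (-s)
  have hT : 0 < T := hsum.tsum_pos (fun n => by positivity) 0 (by positivity)
  refine ⟨3 ^ s * T, by positivity, fun ι v r hr hv hsep => ?_⟩
  -- Each point is sent to its cell in the grid of side `r`; separation in the supremum norm allows
  -- at most one point per cell.
  let N : ι → Fin d → ℤ := fun i k => ⌊v i k / r⌋
  have hN : Function.Injective N := by
    intro i j hij
    by_contra hne
    refine (hsep i j hne).not_gt ((pi_norm_lt_iff hr).2 fun k => ?_)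
    have h := Int.abs_sub_lt_one_of_floor_eq_floor (congrFun hij k)
    rw [← sub_div, abs_div, abs_of_pos hr, div_lt_one hr] at h
    exact h
  have hterm : ∀ i, (1 + ‖v i‖) ^ (-s) ≤
      3 ^ s * r ^ (-s) * (1 + ‖fun k => (N i k : ℝ)‖) ^ (-s) := by
    intro i
    have hv0 := hv i
    have h1 : ‖fun k => (N i k : ℝ)‖ ≤ ‖WithLp.ofLp (v i)‖ / r + 1 := by
      refine (pi_norm_le_iff_of_nonneg (by positivity)).2 fun k => ?_
      refine (abs_floor_le _).trans ?_
      rw [abs_div, abs_of_pos hr]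
      gcongr
      exact norm_le_pi_norm (WithLp.ofLp (v i)) k
    have h2 : 1 ≤ ‖WithLp.ofLp (v i)‖ / r := (one_le_div hr).2 hv0
    have h3 := norm_ofLp_le_norm (v i)
    -- With `t = ‖v i‖_∞ / r ≥ 1`, rounding gives `1 + ‖N i‖ ≤ t + 2 ≤ 3t`; this is where the
    -- distance from the origin is used.
    have h4 : 3⁻¹ * r * (1 + ‖fun k => (N i k : ℝ)‖) ≤ 1 + ‖v i‖ := by
      have : 1 + ‖fun k => (N i k : ℝ)‖ ≤ 3 * (‖WithLp.ofLp (v i)‖ / r) := by linarith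
      calc 3⁻¹ * r * (1 + ‖fun k => (N i k : ℝ)‖)
          ≤ 3⁻¹ * r * (3 * (‖WithLp.ofLp (v i)‖ / r)) := by gcongr
        _ = ‖WithLp.ofLp (v i)‖ := by field_simp
        _ ≤ 1 + ‖v i‖ := by linarith
    calc (1 + ‖v i‖) ^ (-s) ≤ (3⁻¹ * r * (1 + ‖fun k => (N i k : ℝ)‖)) ^ (-s) :=
          Real.rpow_le_rpow_of_nonpos (by positivity) h4 (by linarith)
      _ = _ := by
          rw [Real.mul_rpow (by positivity) (by positivity), Real.mul_rpow (by positivity) hr.le,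
            Real.inv_rpow (by norm_num), ← Real.rpow_neg (by norm_num), neg_neg]
  calc ∑' i, ENNReal.ofReal ((1 + ‖v i‖) ^ (-s))
      ≤ ∑' i, ENNReal.ofReal (3 ^ s * r ^ (-s)) *
          ENNReal.ofReal ((1 + ‖fun k => (N i k : ℝ)‖) ^ (-s)) := by
        refine ENNReal.tsum_le_tsum fun i => ?_
        rw [← ENNReal.ofReal_mul (by positivity)]
        exact ENNReal.ofReal_le_ofReal (hterm i)
    _ ≤ ENNReal.ofReal (3 ^ s * r ^ (-s)) *
          ∑' n : Fin d → ℤ, ENNReal.ofReal ((1 + ‖fun k => (n k : ℝ)‖) ^ (-s)) := by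
        rw [ENNReal.tsum_mul_left]
        gcongr
        exact ENNReal.tsum_comp_le_tsum_of_injective hN
          (fun n : Fin d → ℤ => ENNReal.ofReal ((1 + ‖fun k => (n k : ℝ)‖) ^ (-s)))
    _ = ENNReal.ofReal (3 ^ s * T * r ^ (-s)) := by
        rw [← ENNReal.ofReal_tsum_of_nonneg (fun n => by positivity) hsum,
          ← ENNReal.ofReal_mul (by positivity)]
        congr 1
        ring

end Separated

/-! ### Local finiteness and the total integral of `f ∗ f*` -/

section Diffraction

variable {d : ℕ}

/-- Markov's inequality for `|ĝ|²`, with `g` chosen so that `|ĝ|² ≥ 1/4` on a unit ball around the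
given point. -/
theorem isLocallyFiniteMeasure_of_integrable_fourier {μ : Measure (EuclideanSpace ℝ (Fin d))}
    (h : ∀ f : EuclideanSpace ℝ (Fin d) → ℂ, Continuous f → HasCompactSupport f →
      Integrable (fun ξ => ‖𝓕 f ξ‖ ^ 2) μ) : IsLocallyFiniteMeasure μ := by
  refine ⟨fun x => ⟨Metric.closedBall x 1, Metric.closedBall_mem_nhds x one_pos, ?_⟩⟩
  obtain ⟨g, hg, hgc, hg2⟩ := exists_half_le_norm_fourier (d := d) (‖x‖ + 1) (by positivity)
  refine (measure_mono fun ξ hξ => ?_).trans_lt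
    ((h g hg hgc).measure_norm_ge_lt_top (ε := 1 / 4) (by norm_num))
  have h1 : ‖ξ‖ ≤ ‖x‖ + 1 := by
    have := norm_le_norm_add_norm_sub' ξ x
    rw [mem_closedBall_iff_norm] at hξ
    linarith
  have h2 := hg2 ξ h1
  rw [mem_ofPred_eq, Real.norm_of_nonneg (sq_nonneg _)]
  nlinarith

theorem integral_selfConvolution {f : EuclideanSpace ℝ (Fin d) → ℂ} (hf : Continuous f)
    (hfc : HasCompactSupport f) : ∫ x, selfConvolution f x = ((‖𝓕 f 0‖ ^ 2 : ℝ) : ℂ) := by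
  have hfi := hf.integrable_of_hasCompactSupport hfc (μ := volume)
  have hgi : Integrable fun x => (starRingEnd ℂ) (f (-x)) :=
    (Complex.conjLIE.integrable_comp_iff).2 hfi.comp_neg
  rw [selfConvolution, integral_convolution _ hfi hgi, Real.fourier_eq]
  simp only [ContinuousLinearMap.mul_apply', inner_zero_right, neg_zero, AddChar.map_zero_eq_one,
    one_smul]
  rw [integral_conj, integral_neg_eq_self f, Complex.mul_conj, Complex.normSq_eq_norm_sq]

end Diffraction

/-! ### The diffraction as a Dirac comb and its mass near zero -/

section Lattices

variable {d₁ d₂ : ℕ}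
  (Γ : Submodule ℤ (EuclideanSpace ℝ (Fin d₁) × EuclideanSpace ℝ (Fin d₂)))
  (W : Set (EuclideanSpace ℝ (Fin d₂))) [DiscreteTopology Γ] [IsZLattice ℝ Γ]

/-- An enumeration of the dual lattice by integer vectors. -/
def cpFrequency (n : Module.Free.ChooseBasisIndex ℤ Γ → ℤ) :
    EuclideanSpace ℝ (Fin d₁) × EuclideanSpace ℝ (Fin d₂) :=
  dualVector ((Module.Free.chooseBasis ℤ Γ).ofZLatticeBasis ℝ) n

/-- The Fourier-Bohr amplitude at a frequency of the dual lattice. -/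
def cpAmplitude (n : Module.Free.ChooseBasisIndex ℤ Γ → ℤ) : ℂ :=
  (volume (cpDomain Γ)).toReal⁻¹ • 𝓕 (W.indicator fun _ => (1 : ℂ)) (cpFrequency Γ n).2

/-- The centered diffraction of a cut-and-project process. -/
def cpDiffraction : Measure (EuclideanSpace ℝ (Fin d₁)) :=
  Measure.sum fun n : ({0}ᶜ : Set (Module.Free.ChooseBasisIndex ℤ Γ → ℤ)) =>
    ENNReal.ofReal (‖cpAmplitude Γ W n‖ ^ 2) • Measure.dirac (cpFrequency Γ n.1).1

variable {Γ W}

/-- Parseval for the linear statistic of `f` lifted to the fundamental domain; its coefficients are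
the amplitudes times `f̂` at the first coordinate of the frequency. -/
theorem hasSum_sq_norm_amplitude (hinj : Set.InjOn Prod.fst
      (Γ : Set (EuclideanSpace ℝ (Fin d₁) × EuclideanSpace ℝ (Fin d₂))))
    (hW : MeasurableSet W) (hWb : Bornology.IsBounded W)
    {f : EuclideanSpace ℝ (Fin d₁) → ℂ} (hf : Continuous f) (hfc : HasCompactSupport f) :
    HasSum (fun n => ‖cpAmplitude Γ W n‖ ^ 2 * ‖𝓕 f (cpFrequency Γ n).1‖ ^ 2)
      (∫ ω, ‖∫ y, f y ∂(cpProcess Γ W ω)‖ ^ 2 ∂cpProb Γ) := by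
  have := isAddHaar_volume_prod (d₁ := d₁) (d₂ := d₂)
  have hmp : MeasurePreserving (CPTorus.mk Γ)
      ((volume (cpDomain Γ))⁻¹ • volume.restrict (cpDomain Γ)) (cpProb Γ) :=
    ⟨measurable_cpTorus_mk, rfl⟩
  have hG := (memLp_and_integral_norm_sq_linear_statistic hinj hW hWb hf hfc).1
  have key := hasSum_sq_norm_integral_fundamentalDomain volume
    ((Module.Free.chooseBasis ℤ Γ).ofZLatticeBasis ℝ) (hG.comp_measurePreserving hmp)
  have hmeas := (measurable_integral_cpProcess (Γ := Γ) hinj hW hf).norm.pow_const 2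
  have e1 : ∫ ω, ‖∫ y, f y ∂(cpProcess Γ W ω)‖ ^ 2 ∂cpProb Γ =
      (volume (cpDomain Γ)).toReal⁻¹ •
        ∫ x in cpDomain Γ, ‖∫ y, f y ∂(cpProcess Γ W (CPTorus.mk Γ x))‖ ^ 2 := by
    rw [cpProb_def', integral_smul_measure, integral_map measurable_cpTorus_mk.aemeasurable
      hmeas.aestronglyMeasurable, ENNReal.toReal_inv]
  rw [e1]
  convert! key using 2 with n
  have h := integral_cpDomain_negCharacter hinj hW hWb hf hfc
    (dualVector_mem_dualLattice (Module.Free.chooseBasis ℤ Γ) n)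
  simp only [negCharacter_dualVector] at h
  rw [← mul_pow, ← norm_mul, cpAmplitude, smul_mul_assoc]
  exact congrArg (fun z => ‖(volume (cpDomain Γ)).toReal⁻¹ • z‖ ^ 2)
    ((mul_comm _ _).trans h.symm)

theorem cpAmplitude_zero (hinj : Set.InjOn Prod.fst
      (Γ : Set (EuclideanSpace ℝ (Fin d₁) × EuclideanSpace ℝ (Fin d₂))))
    (hW : MeasurableSet W) :
    cpAmplitude Γ W 0 = (intensity (cpProb Γ) (cpProcess Γ W) : ℂ) := by
  rw [cpAmplitude, cpFrequency, dualVector_zero, Real.fourier_eq, intensity_cpProcess hinj hW]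
  simp [integral_indicator hW, Measure.real]

theorem isCenteredDiffraction_cpDiffraction (hinj : Set.InjOn Prod.fst
      (Γ : Set (EuclideanSpace ℝ (Fin d₁) × EuclideanSpace ℝ (Fin d₂))))
    (hW : MeasurableSet W) (hWb : Bornology.IsBounded W) :
    IsCenteredDiffraction (cpProb Γ) (cpProcess Γ W) (cpDiffraction Γ W) := by
  have hint : ∀ f : EuclideanSpace ℝ (Fin d₁) → ℂ, Continuous f → HasCompactSupport f →
      Integrable (fun ξ => ‖𝓕 f ξ‖ ^ 2) (cpDiffraction Γ W) := by
    intro f hf hfc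
    refine integrable_sum_dirac (fun _ => ENNReal.ofReal_ne_top) ?_
    have := (hasSum_sq_norm_amplitude hinj hW hWb hf hfc).summable.subtype
      ({0}ᶜ : Set (Module.Free.ChooseBasisIndex ℤ Γ → ℤ))
    refine this.congr fun n => ?_
    simp only [Function.comp_apply, ENNReal.toReal_ofReal (sq_nonneg _), norm_pow, norm_norm]
  refine ⟨isLocallyFiniteMeasure_of_integrable_fourier hint, hint, fun f hf hfc => ?_⟩
  have hsum := hasSum_sq_norm_amplitude hinj hW hWb hf hfc
  have h1 : ∫ ξ, ‖𝓕 f ξ‖ ^ 2 ∂cpDiffraction Γ W =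
      ∑' n : ({0}ᶜ : Set (Module.Free.ChooseBasisIndex ℤ Γ → ℤ)),
        ‖cpAmplitude Γ W n‖ ^ 2 * ‖𝓕 f (cpFrequency Γ n.1).1‖ ^ 2 := by
    rw [cpDiffraction, integral_sum_dirac fun _ => ENNReal.ofReal_ne_top]
    refine tsum_congr fun n => ?_
    rw [ENNReal.toReal_ofReal (sq_nonneg _), smul_eq_mul]
  -- The zero frequency is split off: its amplitude is the intensity, so it cancels the centering
  -- term.
  have h2 := hsum.summable.tsum_subtype_add_tsum_subtype_compl {0}
  rw [hsum.tsum_eq, tsum_singleton 0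
    (fun n => ‖cpAmplitude Γ W n‖ ^ 2 * ‖𝓕 f (cpFrequency Γ n).1‖ ^ 2), ← h1] at h2
  have h3 := (memLp_and_integral_norm_sq_linear_statistic hinj hW hWb hf hfc).2
  rw [centeredAutocorrelation, ← h3, integral_selfConvolution hf hfc, ← h2,
    cpAmplitude_zero hinj hW]
  have h4 : (cpFrequency Γ 0).1 = 0 := by rw [cpFrequency, dualVector_zero]; rfl
  rw [h4, Complex.norm_real, Real.norm_eq_abs, sq_abs]
  push_cast
  ring

theorem cpFrequency_mem (n : Module.Free.ChooseBasisIndex ℤ Γ → ℤ) :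
    cpFrequency Γ n ∈ dualLattice Γ :=
  dualVector_mem_dualLattice _ n

/-- Repellence spreads out the second coordinates of the frequencies over a small ball, and Fourier
smoothness makes the masses there summable with a bound that decays in the separation. -/
theorem exists_cpDiffraction_ball_le {ϑ β : ℝ} (hW : IsFourierSmooth W ϑ)
    (hrep : IsRepellentRight (dualLattice Γ) β) :
    ∃ C : ℝ, 0 < C ∧ ∃ ε₀ : ℝ, 0 < ε₀ ∧ ∀ ε : ℝ, 0 < ε → ε < ε₀ →
      cpDiffraction Γ W (Metric.ball 0 ε) ≤ ENNReal.ofReal (C * ε ^ (β * (d₂ + ϑ))) := by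
  obtain ⟨-, hϑ, K, hK⟩ := hW
  obtain ⟨ε₀, hε₀, hrep⟩ := hrep
  obtain ⟨C, hC, hsep⟩ := exists_tsum_separated_le (d := d₂) (s := d₂ + ϑ) (by linarith)
  set V := (volume (cpDomain Γ)).toReal⁻¹
  have hV : 0 ≤ V := inv_nonneg.2 ENNReal.toReal_nonneg
  -- Repellence is applied at scale `2ε` because differences of frequencies are needed; hence `ε₀ /
  -- 2` and the power of `2`. The summand `1` only keeps the constant positive.
  refine ⟨((V * K) ^ 2 + 1) * (C * 2 ^ (β * (d₂ + ϑ))), by positivity, ε₀ / 2, by positivity,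
    fun ε hε hε' => ?_⟩
  have h2ε : 2 * ε < ε₀ := by linarith
  let S : Set ({0}ᶜ : Set (Module.Free.ChooseBasisIndex ℤ Γ → ℤ)) :=
    {n | (cpFrequency Γ n.1).1 ∈ Metric.ball 0 ε}
  have hball : cpDiffraction Γ W (Metric.ball 0 ε) =
      ∑' n : S, ENNReal.ofReal (‖cpAmplitude Γ W n.1.1‖ ^ 2) := by
    rw [cpDiffraction, Measure.sum_apply _ measurableSet_ball]
    refine Eq.trans ?_ (tsum_subtype S fun n => ENNReal.ofReal (‖cpAmplitude Γ W n.1‖ ^ 2)).symm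
    refine tsum_congr fun n => ?_
    by_cases hn : n ∈ S
    · have hn' : (cpFrequency Γ n.1).1 ∈ Metric.ball 0 ε := hn
      rw [indicator_of_mem hn, Measure.smul_apply, Measure.dirac_apply_of_mem hn', smul_eq_mul,
        mul_one]
    · have hn' : (cpFrequency Γ n.1).1 ∉ Metric.ball 0 ε := hn
      rw [indicator_of_notMem hn, Measure.smul_apply,
        Measure.dirac_apply' _ measurableSet_ball, indicator_of_notMem hn', smul_zero]
  have hamp : ∀ n, ‖cpAmplitude Γ W n‖ ^ 2 ≤
      ((V * K) ^ 2 + 1) * (1 + ‖(cpFrequency Γ n).2‖) ^ (-(d₂ + ϑ)) := by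
    intro n
    have hb : (0 : ℝ) ≤ 1 + ‖(cpFrequency Γ n).2‖ := by positivity
    have h := hK (cpFrequency Γ n).2
    rw [cpAmplitude, norm_smul, Real.norm_of_nonneg hV, mul_pow]
    calc V ^ 2 * ‖𝓕 (W.indicator fun _ => (1 : ℂ)) (cpFrequency Γ n).2‖ ^ 2
        ≤ V ^ 2 * (K * (1 + ‖(cpFrequency Γ n).2‖) ^ (-((d₂ + ϑ) / 2))) ^ 2 := by gcongr
      _ = (V * K) ^ 2 * (1 + ‖(cpFrequency Γ n).2‖) ^ (-(d₂ + ϑ)) := by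
          rw [mul_pow, mul_pow, ← Real.rpow_mul_natCast hb, mul_assoc]
          congr 3
          push_cast
          ring
      _ ≤ _ := by
          gcongr
          linarith
  have hmain := hsep S (fun n => (cpFrequency Γ n.1.1).2) ((2 * ε) ^ (-β)) (by positivity)
    (fun n => by
      refine hrep _ (cpFrequency_mem n.1.1) (dualVector_ne_zero _ n.1.2) (2 * ε) (by positivity)
        h2ε ?_
      have : ‖(cpFrequency Γ n.1.1).1‖ < ε := mem_ball_zero_iff.1 n.2
      linarith [norm_ofLp_le_norm (cpFrequency Γ n.1.1).1])
    -- The difference of two frequencies is the frequency of `n - m`, so repellence applies to it as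
    -- well.
    (fun n m hnm => by
      have hne : n.1.1 - m.1.1 ≠ 0 := sub_ne_zero.2 fun h => hnm (Subtype.ext (Subtype.ext h))
      have hsub : cpFrequency Γ (n.1.1 - m.1.1) = cpFrequency Γ n.1.1 - cpFrequency Γ m.1.1 :=
        dualVector_sub _ _ _
      have h := hrep _ (cpFrequency_mem (n.1.1 - m.1.1)) (dualVector_ne_zero _ hne) (2 * ε)
        (by positivity) h2ε
      rw [hsub] at h
      refine h ((norm_ofLp_le_norm _).trans_lt ?_)
      have h1 : ‖(cpFrequency Γ n.1.1).1‖ < ε := mem_ball_zero_iff.1 n.2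
      have h2 : ‖(cpFrequency Γ m.1.1).1‖ < ε := mem_ball_zero_iff.1 m.2
      have h3 := norm_sub_le (cpFrequency Γ n.1.1).1 (cpFrequency Γ m.1.1).1
      rw [Prod.fst_sub]
      linarith)
  rw [hball]
  calc ∑' n : S, ENNReal.ofReal (‖cpAmplitude Γ W n.1.1‖ ^ 2)
      ≤ ∑' n : S, ENNReal.ofReal ((V * K) ^ 2 + 1) *
          ENNReal.ofReal ((1 + ‖(cpFrequency Γ n.1.1).2‖) ^ (-(d₂ + ϑ))) := by
        refine ENNReal.tsum_le_tsum fun n => ?_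
        rw [← ENNReal.ofReal_mul (by positivity)]
        exact ENNReal.ofReal_le_ofReal (hamp _)
    _ ≤ ENNReal.ofReal ((V * K) ^ 2 + 1) *
          ENNReal.ofReal (C * ((2 * ε) ^ (-β)) ^ (-(d₂ + ϑ))) := by
        rw [ENNReal.tsum_mul_left]
        gcongr
    _ = _ := by
        rw [← ENNReal.ofReal_mul (by positivity), ← Real.rpow_mul (by positivity), neg_mul_neg,
          Real.mul_rpow (by norm_num) hε.le]
        congr 1
        ring

end Lattices

end

/-! ### Existence, uniqueness, decay and hyperuniformity -/

theorem mainTheorem4 {d₁ d₂ : ℕ}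
    (Γ : Submodule ℤ (EuclideanSpace ℝ (Fin d₁) × EuclideanSpace ℝ (Fin d₂)))
    [DiscreteTopology Γ] [IsZLattice ℝ Γ]
    (hinj : Set.InjOn Prod.fst
      (Γ : Set (EuclideanSpace ℝ (Fin d₁) × EuclideanSpace ℝ (Fin d₂))))
    (hdense : Dense (Prod.snd ''
      (Γ : Set (EuclideanSpace ℝ (Fin d₁) × EuclideanSpace ℝ (Fin d₂)))))
    (W : Set (EuclideanSpace ℝ (Fin d₂)))
    (hWcompact : IsCompact (closure W)) (hWint : W ⊆ closure (interior W))
    (ϑ : ℝ) (hW : IsFourierSmooth W ϑ)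
    (β : ℝ) (hβ : 0 < β) (hrep : IsRepellentRight (dualLattice Γ) β) :
    (∃! μ : Measure (EuclideanSpace ℝ (Fin d₁)),
      IsCenteredDiffraction (cpProb Γ) (cpProcess Γ W) μ) ∧
    (∀ μ : Measure (EuclideanSpace ℝ (Fin d₁)),
      IsCenteredDiffraction (cpProb Γ) (cpProcess Γ W) μ →
      ∃ C : ℝ, 0 < C ∧ ∃ ε₀ : ℝ, 0 < ε₀ ∧ ∀ ε : ℝ, 0 < ε → ε < ε₀ →
        μ (Metric.ball 0 ε) ≤ ENNReal.ofReal (C * ε ^ (β * (d₂ + ϑ))) ∧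
        μ (Metric.ball 0 ε) / volume (Metric.ball (0 : EuclideanSpace ℝ (Fin d₁)) ε) ≤
          ENNReal.ofReal (C * ε ^ (β * (d₂ + ϑ) - d₁))) ∧
    ((d₁ : ℝ) / (d₂ + ϑ) < β → IsHyperuniform (cpProb Γ) (cpProcess Γ W)) := by
  have hWb : Bornology.IsBounded W := hWcompact.isBounded.subset subset_closure
  have hdiff := isCenteredDiffraction_cpDiffraction hinj hW.1 hWb
  obtain ⟨C, hC, ε₀, hε₀, hle⟩ := exists_cpDiffraction_ball_le hW hrep
  refine ⟨⟨_, hdiff, fun μ hμ => hμ.unique hdiff⟩, fun μ hμ => ?_, fun hlt => ?_⟩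
  · rw [hμ.unique hdiff]
    set v := (volume (Metric.ball (0 : EuclideanSpace ℝ (Fin d₁)) 1)).toReal with hv
    have hv0 : 0 < v :=
      ENNReal.toReal_pos (Metric.measure_ball_pos _ _ one_pos).ne' measure_ball_lt_top.ne
    -- One constant serves both bounds: `C` for the mass and `C / v`, with `v` the volume of the
    -- unit ball, for the quotient.
    refine ⟨C + C / v, by positivity, ε₀, hε₀, fun ε hε hε' => ⟨(hle ε hε hε').trans ?_, ?_⟩⟩
    · refine ENNReal.ofReal_le_ofReal (mul_le_mul_of_nonneg_right ?_ (by positivity))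
      exact le_add_of_nonneg_right (by positivity)
    · have hvol : volume (Metric.ball (0 : EuclideanSpace ℝ (Fin d₁)) ε) =
          ENNReal.ofReal (ε ^ d₁ * v) := by
        rw [Measure.addHaar_ball_of_pos _ _ hε, finrank_euclideanSpace_fin,
          ENNReal.ofReal_mul (by positivity), hv, ENNReal.ofReal_toReal measure_ball_lt_top.ne]
      rw [hvol]
      refine (ENNReal.div_le_div_right (hle ε hε hε') _).trans ?_
      rw [← ENNReal.ofReal_div_of_pos (by positivity)]
      refine ENNReal.ofReal_le_ofReal ?_
      rw [Real.rpow_sub hε, Real.rpow_natCast]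
      calc C * ε ^ (β * (d₂ + ϑ)) / (ε ^ d₁ * v)
          = C / v * (ε ^ (β * (d₂ + ϑ)) / ε ^ d₁) := by field_simp
        _ ≤ (C + C / v) * (ε ^ (β * (d₂ + ϑ)) / ε ^ d₁) := by
          gcongr
          linarith
  · refine ⟨_, hdiff, ?_⟩
    have hs : (0 : ℝ) < d₂ + ϑ := add_pos_of_nonneg_of_pos d₂.cast_nonneg hW.2.1
    have hp : 0 < β * (d₂ + ϑ) - d₁ := by
      rw [div_lt_iff₀ hs] at hlt
      linarith
    have hlim : Tendsto (fun t : ℝ => ENNReal.ofReal (C * t ^ (β * (d₂ + ϑ) - d₁))) (𝓝[>] 0)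
        (𝓝 0) := by
      -- The exponent is positive by the assumption on `β`, so the power is continuous at `0` with
      -- value `0`.
      have h1 : ContinuousAt (fun t : ℝ => ENNReal.ofReal (C * t ^ (β * (d₂ + ϑ) - d₁))) 0 :=
        ENNReal.continuous_ofReal.continuousAt.comp
          (continuousAt_const.mul (Real.continuousAt_rpow_const _ _ (Or.inr hp.le)))
      have h2 := h1.tendsto
      rw [Real.zero_rpow hp.ne', mul_zero, ENNReal.ofReal_zero] at h2
      exact h2.mono_left nhdsWithin_le_nhds
    refine tendsto_of_tendsto_of_tendsto_of_le_of_le' tendsto_const_nhds hlim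
      (Eventually.of_forall fun _ => zero_le) ?_
    filter_upwards [Ioo_mem_nhdsGT hε₀] with t ht
    refine (ENNReal.div_le_div_right (hle t ht.1 ht.2) _).trans ?_
    have ht0 := ht.1
    rw [← ENNReal.ofReal_div_of_pos (by positivity), Real.rpow_sub ht0, Real.rpow_natCast,
      mul_div_assoc]
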